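/- **Theorem 2.9.** Let $p$ be a prime and let $\mathbb{C}_p$ be the completion of an algebraic closure of $\mathbb{Q}_p$, with its $p$-adic absolute value $|\cdot|$. Let $\mathcal{A}(\mathbb{C}_p)$ be the ring of entire functions on $\mathbb{C}_p$ (power series over $\mathbb{C}_p$ converging on all of $\mathbb{C}_p$) and let $\mathcal{M}(\mathbb{C}_p)$, the field of meromorphic functions, be its field of fractions. Let $f(x)=\sum_{n\ge N}a_nx^n\in\mathcal{A}(\mathbb{C}_p)$, where $N\ge 0$ is an integer and $a_n\ne 0$ for every $n\ge N$. Suppose that there is an integer $n_0\ge N$ such that the sequence $(|a_n/a_{n+1}|)_{n\ge n_0}$ is strictly increasing and unbounded. Then: 1. $f$ is pseudo-prime: whenever $f=g\circ h$ with $g,h\in\mathcal{M}(\mathbb{C}_p)$, at least one of $g,h$ is a rational function. Here $f=g\circ h$ means that $h$ is not constantly equal to a pole of $g$, and that $f(x)=g(h(x))$ at every $x$ that is not a pole of $h$ and for which $h(x)$ is not a pole of $g$. 2. For every $\beta\in\mathbb{C}_p$, the function $f-\beta$ has only finitely many multiple zeros, i.e. points $x\in\mathbb{C}_p$ with $f(x)=\beta$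 and $f'(x)=0$. -/

import Mathlib

namespace PadicFactorization

open Filter Topology

/-- The ring `𝒜(ℂ_p)` of entire functions on `ℂ_p`, each given by its Taylor series at `0`:
the power series `∑ aₙ Xⁿ` over `ℂ_p` with `|aₙ| rⁿ → 0` for every `r > 0`, that is, those
which converge at every point of `ℂ_p`. -/
def entireSubring (p : ℕ) [Fact p.Prime] : Subring (PowerSeries ℂ_[p]) where
  carrier := {f | ∀ r : ℝ, 0 < r →
    Tendsto (fun n : ℕ => ‖PowerSeries.coeff n f‖ * r ^ n) atTop (𝓝 0)}
  mul_mem' := by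
    intro f g hf hg r hr
    exact (PowerSeries.isRestricted_iff' r _).1 (PowerSeries.isRestricted.mul r
      ((PowerSeries.isRestricted_iff' r f).2 (hf r hr))
      ((PowerSeries.isRestricted_iff' r g).2 (hg r hr)))
  one_mem' := fun r _ => (PowerSeries.isRestricted_iff' r _).1 (PowerSeries.isRestricted_one r)
  add_mem' := by
    intro f g hf hg r hr
    exact (PowerSeries.isRestricted_iff' r _).1 (PowerSeries.isRestricted.add r
      ((PowerSeries.isRestricted_iff' r f).2 (hf r hr))
      ((PowerSeries.isRestricted_iff' r g).2 (hg r hr)))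
  zero_mem' := fun r _ => (PowerSeries.isRestricted_iff' r _).1 (PowerSeries.isRestricted_zero r)
  neg_mem' := by
    intro f hf r hr
    exact (PowerSeries.isRestricted_iff' r _).1 (PowerSeries.isRestricted.neg r
      ((PowerSeries.isRestricted_iff' r f).2 (hf r hr)))

/-- The type of entire functions on `ℂ_p`. -/
abbrev Entire (p : ℕ) [Fact p.Prime] : Type := entireSubring p

/-- The field `ℳ(ℂ_p)` of meromorphic functions on `ℂ_p`: the fraction field of the integral
domain `𝒜(ℂ_p)`. -/
abbrev Mero (p : ℕ) [Fact p.Prime] : Type := FractionRing (Entire p)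

variable {p : ℕ} [Fact p.Prime]

/-- The value `f(x) = ∑ aₙ xⁿ` of an entire function at a point (the series converges). -/
noncomputable def Entire.eval (f : Entire p) (x : ℂ_[p]) : ℂ_[p] :=
  ∑' n : ℕ, PowerSeries.coeff n (f : PowerSeries ℂ_[p]) * x ^ n

/-- An entire function that is a polynomial. -/
def Entire.IsPolynomial (f : Entire p) : Prop :=
  ∃ P : Polynomial ℂ_[p], (f : PowerSeries ℂ_[p]) = (P : PowerSeries ℂ_[p])

/-- A meromorphic function that is a rational function: a quotient of two polynomials. -/
def Mero.IsRational (h : Mero p) : Prop :=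
  ∃ a b : Entire p, a.IsPolynomial ∧ b.IsPolynomial ∧ b ≠ 0 ∧
    h = algebraMap (Entire p) (Mero p) a / algebraMap (Entire p) (Mero p) b

/-- `h` is regular (has no pole) at `x`, and takes the value `y` there: `h = a / b` for some
entire `a`, `b` with `b(x) ≠ 0` and `y = a(x) / b(x)`. -/
def Mero.HasValueAt (h : Mero p) (x y : ℂ_[p]) : Prop :=
  ∃ a b : Entire p, b.eval x ≠ 0 ∧
    h = algebraMap (Entire p) (Mero p) a / algebraMap (Entire p) (Mero p) b ∧
    y = a.eval x / b.eval x

/-- `F = f ∘ g` for meromorphic functions: the composite is defined somewhere (`g` is not constantly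
equal to a pole of `f`), and `F(x) = f(g(x))` whenever `g` is regular at `x` and `f` is regular
at `g(x)`. When `g` is not such a constant, these points are all but a countable set, so that they
determine `F`. -/
def Mero.IsComp (F f g : Mero p) : Prop :=
  (∃ x y z : ℂ_[p], g.HasValueAt x y ∧ f.HasValueAt y z) ∧
    ∀ x y z : ℂ_[p], g.HasValueAt x y → f.HasValueAt y z → F.HasValueAt x z

/-- `F` is pseudo-prime: in every factorization `F = f ∘ g` with meromorphic factors, `f` or `g`
is a rational function. -/
def Mero.IsPseudoPrime (F : Mero p) : Prop :=
  ∀ f g : Mero p, F.IsComp f g → f.IsRational ∨ g.IsRational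

/-- `x` is a multiple zero of the (differentiable) function `h`: both `h` and `h'` vanish at `x`. -/
def IsMultipleZero (h : ℂ_[p] → ℂ_[p]) (x : ℂ_[p]) : Prop :=
  h x = 0 ∧ deriv h x = 0

end PadicFactorization

open PadicFactorization

namespace PadicFactorization

open Filter Topology PowerSeries

/-! ### Ultrametric estimates for sums and series -/

section Series

variable {K : Type*} [NormedField K] [IsUltrametricDist K]

/-! Write f = ∑ aₙ Xⁿ. Since the ratios |aₙ/aₙ₊₁| increase strictly, on a large circle |x| = r only
two consecutive terms, n and n + 1, can be maximal. If f(y) = β there, β is negligible, so these two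
terms have equal norm and nearly cancel. Inserting this into (f(x) - f(y))/(x - y) leaves one
strictly dominant term, so the divided difference is nonzero whenever |x| = |y| is large and f(x) =
f(y) = β (`exists_forall_seriesSlope_ne_zero`).

On the diagonal the divided difference is f'(x): the multiple zeros of f - β lie in a disc, and f -
β has finitely many zeros there. Off the diagonal, f takes the value β at most once on each large
circle. Now let f = g ∘ h with neither factor rational. Both are then entire and not polynomials
(`Mero.IsComp.exists_entire`): a pole of h would confine the poles of g to a disc, and f would take
a value other than f(x₀) arbitrarily close to that pole x₀. Choose w ≠ 0 with g(w) = g(0) and a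
large zero x of h. Some y with h(y) = w satisfies |y - x| < |x|, hence |y| = |x|, and f(x) = f(y) is
a contradiction (`exists_two_zeros_of_comp`).

Zeros come from `IsLastDominant.exists_zero_near`, as limits of roots of truncations. Dividing them
out one at a time (`IsLastDominant.divXSub`) plays the role of Weierstrass preparation. -/

theorem norm_sum_lt_of_forall_lt {ι : Type*} {s : Finset ι} {u : ι → K} {c : ℝ} (hc : 0 < c)
    (h : ∀ i ∈ s, ‖u i‖ < c) : ‖∑ i ∈ s, u i‖ < c := by
  rcases s.eq_empty_or_nonempty with rfl | hs
  · simpa using hc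
  · obtain ⟨i, hi, hle⟩ := IsUltrametricDist.exists_norm_finsetSum_le_of_nonempty hs u
    exact hle.trans_lt (h i hi)

/-- The supremum of a real sequence tending to zero, one of whose terms is positive, is attained. -/
theorem exists_forall_le_of_tendsto_zero {u : ℕ → ℝ} (hu : Tendsto u atTop (𝓝 0))
    {m : ℕ} (hm : 0 < u m) : ∃ k, 0 < u k ∧ ∀ n, u n ≤ u k := by
  obtain ⟨M, hM⟩ := (hu.eventually (gt_mem_nhds hm)).exists_forall_of_atTop
  obtain ⟨k, -, hk⟩ := Finset.exists_max_image (Finset.range (max M m + 1)) u ⟨m, by simp⟩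
  have hmk : u m ≤ u k := hk m (by simp)
  refine ⟨k, hm.trans_le hmk, fun n => ?_⟩
  by_cases hn : M ≤ n
  · exact (hM n hn).le.trans hmk
  · exact hk n (by simp; omega)

theorem exists_lt_forall_le_of_tendsto_zero {u : ℕ → ℝ} (hu : Tendsto u atTop (𝓝 0)) {c : ℝ}
    (hc : 0 < c) (h : ∀ n, u n < c) : ∃ d, 0 ≤ d ∧ d < c ∧ ∀ n, u n ≤ d := by
  by_cases hp : ∃ m, 0 < u m
  · obtain ⟨m, hm⟩ := hp
    obtain ⟨k, hk0, hk⟩ := exists_forall_le_of_tendsto_zero hu hm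
    exact ⟨u k, hk0.le, h k, hk⟩
  · push Not at hp
    exact ⟨0, le_rfl, hc, hp⟩

theorem norm_tsum_lt_of_forall_lt {u : ℕ → K} (hu : Tendsto (fun n => ‖u n‖) atTop (𝓝 0)) {c : ℝ}
    (hc : 0 < c) (h : ∀ n, ‖u n‖ < c) : ‖∑' n, u n‖ < c := by
  obtain ⟨d, hd0, hdc, hd⟩ := exists_lt_forall_le_of_tendsto_zero hu hc h
  exact (IsUltrametricDist.norm_tsum_le_of_forall_le_of_nonneg hd0 hd).trans_lt hdc

theorem norm_add_lt_of_lt {x y : K} {c : ℝ} (hx : ‖x‖ < c) (hy : ‖y‖ < c) : ‖x + y‖ < c :=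
  (IsUltrametricDist.norm_add_le_max x y).trans_lt (max_lt hx hy)

theorem norm_sub_lt_of_lt {x y : K} {c : ℝ} (hx : ‖x‖ < c) (hy : ‖y‖ < c) : ‖x - y‖ < c := by
  rw [sub_eq_add_neg]; exact norm_add_lt_of_lt hx (by rwa [norm_neg])

theorem norm_add_le_of_le' {x y : K} {c : ℝ} (hx : ‖x‖ ≤ c) (hy : ‖y‖ ≤ c) : ‖x + y‖ ≤ c :=
  (IsUltrametricDist.norm_add_le_max x y).trans (max_le hx hy)

theorem norm_sub_le_of_le' {x y : K} {c : ℝ} (hx : ‖x‖ ≤ c) (hy : ‖y‖ ≤ c) : ‖x - y‖ ≤ c := by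
  rw [sub_eq_add_neg]; exact norm_add_le_of_le' hx (by rwa [norm_neg])

theorem norm_add_eq_left_of_lt {x y : K} (h : ‖y‖ < ‖x‖) : ‖x + y‖ = ‖x‖ := by
  rw [IsUltrametricDist.norm_add_eq_max_of_norm_ne_norm h.ne', max_eq_left h.le]

theorem norm_sub_eq_left_of_lt {x y : K} (h : ‖y‖ < ‖x‖) : ‖x - y‖ = ‖x‖ := by
  rw [sub_eq_add_neg]; exact norm_add_eq_left_of_lt (by rwa [norm_neg])

end Series

/-! ### Everywhere convergent power series and their values -/

section Entire

variable {K : Type*} [NormedField K]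

/-- The power series `f` converges on the whole field. -/
def IsEntire (f : PowerSeries K) : Prop :=
  ∀ r : ℝ, 0 < r → Tendsto (fun n : ℕ => ‖coeff n f‖ * r ^ n) atTop (𝓝 0)

/-- The sum of the power series `f` at `x`. -/
noncomputable def seriesEval (f : PowerSeries K) (x : K) : K := ∑' n : ℕ, coeff n f * x ^ n

theorem IsEntire.tendsto {f : PowerSeries K} (hf : IsEntire f) {r : ℝ} (hr : 0 ≤ r) :
    Tendsto (fun n : ℕ => ‖coeff n f‖ * r ^ n) atTop (𝓝 0) := by
  have h1 : (0 : ℝ) < r + 1 := by positivity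
  refine squeeze_zero (fun n => by positivity) (fun n => ?_) (hf _ h1)
  gcongr
  linarith

/-- A bound at radius r + 1 gives geometric decay at radius r. Testing only radii above 1 leaves
room for index shifts, since powers of r then increase. -/
theorem isEntire_of_bounded {f : PowerSeries K}
    (h : ∀ r : ℝ, 1 < r → ∃ C, ∀ n, ‖coeff n f‖ * r ^ n ≤ C) : IsEntire f := by
  intro r hr
  obtain ⟨C, hC⟩ := h (r + 1) (by linarith)
  have h2 : Tendsto (fun n : ℕ => C * (r / (r + 1)) ^ n) atTop (𝓝 0) := by
    simpa using (tendsto_pow_atTop_nhds_zero_of_lt_one (by positivity : 0 ≤ r / (r + 1))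
      (by rw [div_lt_one] <;> linarith)).const_mul C
  refine squeeze_zero (fun n => by positivity) (fun n => ?_) h2
  have : r ^ n = (r + 1) ^ n * (r / (r + 1)) ^ n := by
    rw [← mul_pow]; congr 1; field_simp
  rw [this, ← mul_assoc]
  gcongr
  exact hC n

theorem IsEntire.bounded {f : PowerSeries K} (hf : IsEntire f) {r : ℝ} (hr : 0 ≤ r) :
    ∃ C, 0 ≤ C ∧ ∀ n, ‖coeff n f‖ * r ^ n ≤ C := by
  obtain ⟨C, hC⟩ := (hf.tendsto hr).bddAbove_range
  refine ⟨max C 0, le_max_right _ _, fun n => le_max_of_le_left (hC ⟨n, rfl⟩)⟩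

theorem IsEntire.summable {f : PowerSeries K} (hf : IsEntire f) {r : ℝ} (hr : 0 ≤ r) :
    Summable (fun n : ℕ => ‖coeff n f‖ * r ^ n) := by
  obtain ⟨C, -, hC⟩ := hf.bounded (r := 2 * (r + 1)) (by positivity)
  have h2 : Summable (fun n : ℕ => C * (1 / 2 : ℝ) ^ n) :=
    (summable_geometric_of_lt_one (by norm_num) (by norm_num)).mul_left C
  refine Summable.of_nonneg_of_le (fun n => by positivity) (fun n => ?_) h2
  calc ‖coeff n f‖ * r ^ n ≤ ‖coeff n f‖ * (r + 1) ^ n := by gcongr; linarith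
    _ = (‖coeff n f‖ * (2 * (r + 1)) ^ n) * (1 / 2 : ℝ) ^ n := by
      rw [mul_pow, mul_assoc, mul_comm ((2 : ℝ) ^ n), mul_assoc, ← mul_pow]; simp
    _ ≤ _ := by gcongr; exact hC n

theorem IsEntire.summable_norm {f : PowerSeries K} (hf : IsEntire f) (x : K) :
    Summable (fun n : ℕ => ‖coeff n f * x ^ n‖) := by
  simpa [norm_mul, norm_pow] using hf.summable (norm_nonneg x)

theorem isEntire_C (c : K) : IsEntire (C c) := by
  intro r _
  refine tendsto_const_nhds.congr' ?_
  filter_upwards [eventually_ge_atTop 1] with n hn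
  rw [coeff_C, if_neg (by omega)]; simp

theorem IsEntire.add {f g : PowerSeries K} (hf : IsEntire f) (hg : IsEntire g) :
    IsEntire (f + g) := fun r hr => (isRestricted_iff' r _).1
  (isRestricted.add r ((isRestricted_iff' r f).2 (hf r hr)) ((isRestricted_iff' r g).2 (hg r hr)))

theorem IsEntire.neg {f : PowerSeries K} (hf : IsEntire f) : IsEntire (-f) :=
  fun r hr => (isRestricted_iff' r _).1 (isRestricted.neg r ((isRestricted_iff' r f).2 (hf r hr)))

theorem IsEntire.sub {f g : PowerSeries K} (hf : IsEntire f) (hg : IsEntire g) :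
    IsEntire (f - g) := by rw [sub_eq_add_neg]; exact hf.add hg.neg

theorem IsEntire.mul [IsUltrametricDist K] {f g : PowerSeries K} (hf : IsEntire f)
    (hg : IsEntire g) : IsEntire (f * g) := fun r hr => (isRestricted_iff' r _).1
  (isRestricted.mul r ((isRestricted_iff' r f).2 (hf r hr)) ((isRestricted_iff' r g).2 (hg r hr)))

theorem isEntire_polynomial (P : Polynomial K) : IsEntire (P : PowerSeries K) := by
  intro r _
  refine tendsto_const_nhds.congr' ?_
  filter_upwards [eventually_gt_atTop P.natDegree] with n hn
  rw [Polynomial.coeff_coe, Polynomial.coeff_eq_zero_of_natDegree_lt hn]; simp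

@[simp]
theorem seriesEval_C (c x : K) : seriesEval (C c) x = c := by
  rw [seriesEval, tsum_eq_single 0]
  · simp
  · intro n hn; rw [coeff_C, if_neg hn, zero_mul]

theorem seriesEval_polynomial (P : Polynomial K) (x : K) :
    seriesEval (P : PowerSeries K) x = P.eval x := by
  rw [seriesEval, Polynomial.eval_eq_sum_range, tsum_eq_sum (s := Finset.range (P.natDegree + 1))]
  · simp
  · intro n hn
    rw [Polynomial.coeff_coe, Polynomial.coeff_eq_zero_of_natDegree_lt (by simpa using hn),
      zero_mul]

variable [CompleteSpace K]

theorem IsEntire.summable_eval {f : PowerSeries K} (hf : IsEntire f) (x : K) :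
    Summable (fun n : ℕ => coeff n f * x ^ n) := (hf.summable_norm x).of_norm

theorem seriesEval_sub {f g : PowerSeries K} (hf : IsEntire f) (hg : IsEntire g) (x : K) :
    seriesEval (f - g) x = seriesEval f x - seriesEval g x := by
  rw [seriesEval, seriesEval, seriesEval, ← (hf.summable_eval x).tsum_sub (hg.summable_eval x)]
  simp [sub_mul]

theorem seriesEval_mul {f g : PowerSeries K} (hf : IsEntire f) (hg : IsEntire g) (x : K) :
    seriesEval (f * g) x = seriesEval f x * seriesEval g x := by
  rw [seriesEval, seriesEval, seriesEval,
    tsum_mul_tsum_eq_tsum_sum_antidiagonal_of_summable_norm (hf.summable_norm x)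
      (hg.summable_norm x)]
  refine tsum_congr fun n => ?_
  rw [coeff_mul, Finset.sum_mul]
  refine Finset.sum_congr rfl fun ij hij => ?_
  rw [← Finset.HasAntidiagonal.mem_antidiagonal.1 hij, pow_add]
  ring

theorem IsEntire.continuous {f : PowerSeries K} (hf : IsEntire f) : Continuous (seriesEval f) := by
  rw [continuous_iff_continuousAt]
  intro x
  have hx : Metric.ball (0 : K) (‖x‖ + 1) ∈ 𝓝 x :=
    Metric.isOpen_ball.mem_nhds (by simp)
  refine ContinuousOn.continuousAt (s := Metric.ball 0 (‖x‖ + 1)) ?_ hx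
  refine continuousOn_tsum (fun n => by fun_prop)
    (hf.summable (by positivity : (0 : ℝ) ≤ ‖x‖ + 1)) fun n y hy => ?_
  rw [norm_mul, norm_pow]
  gcongr
  simpa using (mem_ball_zero_iff.1 hy).le

end Entire

/-- `N` is the last index at which `‖aₙ‖ rⁿ` is maximal, where `f = ∑ aₙ Xⁿ`. -/
structure IsLastDominant {K : Type*} [NormedField K] (f : PowerSeries K) (r : ℝ) (N : ℕ) :
    Prop where
  le : ∀ k, ‖coeff k f‖ * r ^ k ≤ ‖coeff N f‖ * r ^ N
  lt : ∀ k, N < k → ‖coeff k f‖ * r ^ k < ‖coeff N f‖ * r ^ N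

/-! ### Locating roots of polynomials from their coefficients -/

section Polynomial

variable {K : Type*} [NormedField K] [IsUltrametricDist K]

/-- By Vieta, the coefficient of degree k is a signed sum of products omitting k of the roots, and
each omitted root has norm at least r. -/
theorem norm_coeff_prod_X_sub_C_mul_pow_le (s : Multiset K) {r : ℝ} (hr : 0 ≤ r)
    (hs : ∀ ρ ∈ s, r ≤ ‖ρ‖) (k : ℕ) :
    ‖((s.map fun ρ => Polynomial.X - Polynomial.C ρ).prod).coeff k‖ * r ^ k ≤
      ‖((s.map fun ρ => Polynomial.X - Polynomial.C ρ).prod).coeff 0‖ := by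
  induction s using Multiset.induction_on generalizing k with
  | empty =>
    rcases eq_or_ne k 0 with rfl | hk
    · simp
    · simp [Polynomial.coeff_one, hk]
  | cons ρ s ih =>
    have ih' := ih fun x hx => hs x (Multiset.mem_cons_of_mem hx)
    have hρ := hs ρ (Multiset.mem_cons_self ρ s)
    set P := (s.map fun ρ => Polynomial.X - Polynomial.C ρ).prod with hP
    rw [Multiset.map_cons, Multiset.prod_cons, ← hP]
    have h0 : ‖((Polynomial.X - Polynomial.C ρ) * P).coeff 0‖ = ‖ρ‖ * ‖P.coeff 0‖ := by
      rw [sub_mul, Polynomial.coeff_sub, Polynomial.coeff_X_mul_zero, Polynomial.coeff_C_mul,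
        zero_sub, norm_neg, norm_mul]
    rw [h0]
    rcases k with _ | k
    · rw [h0]; simp
    · have h1 : ‖P.coeff k‖ * r ^ (k + 1) ≤ ‖ρ‖ * ‖P.coeff 0‖ := by
        calc ‖P.coeff k‖ * r ^ (k + 1) = r * (‖P.coeff k‖ * r ^ k) := by ring
          _ ≤ ‖ρ‖ * ‖P.coeff 0‖ := mul_le_mul hρ (ih' k) (by positivity) (norm_nonneg _)
      have h2 : ‖ρ‖ * ‖P.coeff (k + 1)‖ * r ^ (k + 1) ≤ ‖ρ‖ * ‖P.coeff 0‖ := by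
        rw [mul_assoc]; gcongr; exact ih' (k + 1)
      rw [sub_mul, Polynomial.coeff_sub, Polynomial.coeff_X_mul, Polynomial.coeff_C_mul]
      have h3 := IsUltrametricDist.norm_add_le_max (P.coeff k) (-(ρ * P.coeff (k + 1)))
      rw [← sub_eq_add_neg, norm_neg, norm_mul] at h3
      refine (mul_le_mul_of_nonneg_right h3 (by positivity)).trans ?_
      rw [max_mul_of_nonneg _ _ (by positivity)]
      exact max_le h1 h2

/-- The n-th Taylor coefficient at x is the sum of (k choose n) qₖ x^(k-n) over k ≥ n. Binomials
have norm at most 1, and strict dominance over later indices makes every term with k > n smaller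
than qₙ. This is why the last dominant index is the one recorded. -/
theorem IsLastDominant.norm_coeff_taylor {Q : Polynomial K} {r : ℝ} {n : ℕ} (hr : 0 < r)
    (hQ : IsLastDominant (Q : PowerSeries K) r n) {x : K} (hx : ‖x‖ ≤ r) :
    ‖(Polynomial.taylor x Q).coeff n‖ = ‖Q.coeff n‖ := by
  have hsmall : ∀ k, n < k → ‖(k.choose n : K) * Q.coeff k * x ^ (k - n)‖ < ‖Q.coeff n‖ := by
    intro k hk
    have h1 := hQ.lt k hk
    rw [Polynomial.coeff_coe, Polynomial.coeff_coe] at h1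
    have h2 : r ^ k = r ^ (k - n) * r ^ n := by rw [← pow_add]; congr 1; omega
    rw [h2, ← mul_assoc] at h1
    have h3 := lt_of_mul_lt_mul_right h1 (by positivity)
    refine lt_of_le_of_lt ?_ h3
    rw [norm_mul, norm_mul, norm_pow]
    have h4 : ‖(k.choose n : K)‖ ≤ 1 := IsUltrametricDist.norm_natCast_le_one K _
    calc _ ≤ 1 * ‖Q.coeff k‖ * r ^ (k - n) := by gcongr
      _ = _ := by rw [one_mul]
  have hpos : 0 < ‖Q.coeff n‖ := (norm_nonneg _).trans_lt (hsmall (n + 1) (by omega))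
  rw [Polynomial.taylor_coeff, Polynomial.hasseDeriv_apply, Polynomial.sum_def,
    Polynomial.eval_finsetSum]
  have hmem : n ∈ Q.support := by
    rw [Polynomial.mem_support_iff]; exact norm_pos_iff.1 hpos
  rw [← Finset.add_sum_erase _ _ hmem]
  have hlt : ‖∑ k ∈ Q.support.erase n, Polynomial.eval x
      (Polynomial.monomial (k - n) ((k.choose n : K) * Q.coeff k))‖ < ‖Q.coeff n‖ := by
    refine norm_sum_lt_of_forall_lt hpos fun k hk => ?_
    rw [Polynomial.eval_monomial]
    rcases lt_or_gt_of_ne (Finset.ne_of_mem_erase hk) with h | h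
    · rw [Nat.choose_eq_zero_of_lt h]; simpa using hpos
    · exact hsmall k h
  have he : Polynomial.eval x (Polynomial.monomial (n - n) ((n.choose n : K) * Q.coeff n)) =
      Q.coeff n := by simp
  rw [he]
  exact norm_add_eq_left_of_lt hlt

variable [IsAlgClosed K]

/-- If `T` has a nonzero coefficient of degree `n ≥ 1`, then some root of `T` is as small as that
coefficient and the constant one force it to be. -/
theorem exists_isRoot_norm_coeff_mul_pow_le (T : Polynomial K) {n : ℕ} (hn : 1 ≤ n)
    (hT : T.coeff n ≠ 0) : ∃ t, T.eval t = 0 ∧ ‖T.coeff n‖ * ‖t‖ ^ n ≤ ‖T.coeff 0‖ := by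
  classical
  have hT0 : T ≠ 0 := by rintro rfl; simp at hT
  have hdeg : T.degree ≠ 0 := by
    intro h
    exact hT (Polynomial.coeff_eq_zero_of_degree_lt (by rw [h]; exact_mod_cast hn))
  obtain ⟨t₀, ht₀⟩ := IsAlgClosed.exists_root T hdeg
  -- A root of least norm, so that all roots have norm at least ‖t‖ and the product estimate applies
  -- with r = ‖t‖.
  obtain ⟨t, ht, hmin⟩ := Finset.exists_min_image T.roots.toFinset norm
    ⟨t₀, by simpa [hT0] using ht₀⟩
  have ht' : T.eval t = 0 := by
    have := (Multiset.mem_toFinset.1 ht); simpa [hT0] using this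
  refine ⟨t, ht', ?_⟩
  have hsplit := (IsAlgClosed.splits T).eq_prod_roots
  have key := norm_coeff_prod_X_sub_C_mul_pow_le T.roots (norm_nonneg t)
    (fun ρ hρ => hmin ρ (Multiset.mem_toFinset.2 hρ)) n
  have hc : ∀ k, T.coeff k = T.leadingCoeff *
      ((T.roots.map fun ρ => Polynomial.X - Polynomial.C ρ).prod).coeff k := fun k => by
    conv_lhs => rw [hsplit]
    rw [Polynomial.coeff_C_mul]
  rw [hc n, hc 0, norm_mul, norm_mul, mul_assoc]
  gcongr

/-- Recentring at x turns the distance from x to a root into the norm of a root, and the coefficient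
of degree n keeps its norm. -/
theorem IsLastDominant.exists_polynomial_root_near {Q : Polynomial K} {r : ℝ} {n : ℕ} (hr : 0 < r)
    (hn : 1 ≤ n) (hQ : IsLastDominant (Q : PowerSeries K) r n) {x : K} (hx : ‖x‖ ≤ r) :
    ∃ ξ, Q.eval ξ = 0 ∧ ‖Q.coeff n‖ * ‖ξ - x‖ ^ n ≤ ‖Q.eval x‖ := by
  have h1 := hQ.norm_coeff_taylor hr hx
  have hpos : 0 < ‖Q.coeff n‖ := by
    have h := hQ.lt (n + 1) (by omega)
    rw [Polynomial.coeff_coe, Polynomial.coeff_coe] at h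
    have h2 : 0 < ‖Q.coeff n‖ * r ^ n := lt_of_le_of_lt (by positivity) h
    exact pos_of_mul_pos_left h2 (by positivity)
  obtain ⟨t, ht, hle⟩ := exists_isRoot_norm_coeff_mul_pow_le (Polynomial.taylor x Q) hn
    (norm_pos_iff.1 (h1 ▸ hpos))
  rw [Polynomial.taylor_eval] at ht
  rw [h1, Polynomial.taylor_coeff_zero] at hle
  exact ⟨t + x, ht, by simpa using hle⟩

end Polynomial

/-! ### Dominant terms of a series on a disc -/

section Dominant

variable {K : Type*} [NormedField K] {f : PowerSeries K} {r : ℝ} {n : ℕ}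

theorem IsLastDominant.pos (h : IsLastDominant f r n) (hr : 0 ≤ r) :
    0 < ‖coeff n f‖ * r ^ n :=
  lt_of_le_of_lt (by positivity) (h.lt (n + 1) (by omega))

theorem IsLastDominant.coeff_ne_zero (h : IsLastDominant f r n) (hr : 0 ≤ r) :
    coeff n f ≠ 0 :=
  norm_pos_iff.1 (pos_of_mul_pos_left (h.pos hr) (by positivity))

theorem IsEntire.exists_isLastDominant (hf : IsEntire f) (h0 : f ≠ 0) (hr : 0 < r) :
    ∃ n, IsLastDominant f r n := by
  obtain ⟨m, hm⟩ := exists_coeff_ne_zero_iff_ne_zero.2 h0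
  obtain ⟨k, hk0, hk⟩ := exists_forall_le_of_tendsto_zero (hf r hr) (m := m)
    (by have := norm_pos_iff.2 hm; positivity)
  obtain ⟨M, hM⟩ := ((hf r hr).eventually (gt_mem_nhds hk0)).exists_forall_of_atTop
  classical
  let S := (Finset.range (M + k + 1)).filter fun j => ‖coeff j f‖ * r ^ j = ‖coeff k f‖ * r ^ k
  have hS : S.Nonempty := ⟨k, by simp [S]⟩
  have hmem := S.max'_mem hS
  set j := S.max' hS
  have hj : ‖coeff j f‖ * r ^ j = ‖coeff k f‖ * r ^ k := (Finset.mem_filter.1 hmem).2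
  refine ⟨j, fun i => hj ▸ hk i, fun i hi => ?_⟩
  rw [hj]
  refine lt_of_le_of_ne (hk i) fun he => ?_
  by_cases hiM : M ≤ i
  · exact (hM i hiM).ne he
  · have : i ∈ S := by simp [S, he]; omega
    exact absurd (S.le_max' i this) (by omega)

theorem IsLastDominant.one_le (h : IsLastDominant f r n) {k : ℕ} (hk : 1 ≤ k)
    (hle : ‖coeff 0 f‖ ≤ ‖coeff k f‖ * r ^ k) : 1 ≤ n := by
  by_contra hn
  obtain rfl : n = 0 := by omega
  have := h.lt k (by omega)
  simp only [pow_zero, mul_one] at this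
  linarith

theorem IsLastDominant.trunc (hr : 0 < r) (h : IsLastDominant f r n) {m : ℕ} (hm : n < m) :
    IsLastDominant (trunc m f : PowerSeries K) r n := by
  have hc : ∀ k, ‖coeff k (PowerSeries.trunc m f : PowerSeries K)‖ * r ^ k ≤
      ‖coeff k f‖ * r ^ k := by
    intro k
    rw [Polynomial.coeff_coe, coeff_trunc]
    split_ifs
    · exact le_rfl
    · simp only [norm_zero, zero_mul]; positivity
  have hn : coeff n (PowerSeries.trunc m f : PowerSeries K) = coeff n f := by
    rw [Polynomial.coeff_coe, coeff_trunc, if_pos hm]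
  exact ⟨fun k => hn ▸ (hc k).trans (h.le k), fun k hk => hn ▸ (hc k).trans_lt (h.lt k hk)⟩

end Dominant

/-! ### Zeros of entire series as limits of roots of truncations -/

section Roots

variable {K : Type*} [NormedField K] [IsUltrametricDist K] {f : PowerSeries K} {r : ℝ} {n : ℕ}

theorem IsLastDominant.norm_seriesEval_le (h : IsLastDominant f r n) {x : K} (hx : ‖x‖ ≤ r) :
    ‖seriesEval f x‖ ≤ ‖coeff n f‖ * r ^ n := by
  have hr : 0 ≤ r := (norm_nonneg x).trans hx
  refine IsUltrametricDist.norm_tsum_le_of_forall_le_of_nonneg (by positivity) fun k => ?_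
  rw [norm_mul, norm_pow]
  exact le_trans (by gcongr) (h.le k)

variable [CompleteSpace K]

theorem IsLastDominant.seriesEval_ne_zero (hf : IsEntire f) (h : IsLastDominant f r 0) {x : K}
    (hx : ‖x‖ ≤ r) : seriesEval f x ≠ 0 := by
  have hr : 0 ≤ r := (norm_nonneg x).trans hx
  have hpos := h.pos hr
  have h1 : ‖∑' k, coeff (k + 1) f * x ^ (k + 1)‖ < ‖coeff 0 f‖ * r ^ 0 := by
    refine norm_tsum_lt_of_forall_lt ?_ hpos fun k => ?_
    · have h2 := (tendsto_add_atTop_iff_nat 1).2 (hf.tendsto (norm_nonneg x))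
      simpa [norm_mul, norm_pow] using h2
    · rw [norm_mul, norm_pow]
      exact lt_of_le_of_lt (by gcongr) (h.lt (k + 1) (by omega))
  rw [pow_zero, mul_one] at h1
  rw [seriesEval, (hf.summable_eval x).tsum_eq_zero_add, ← norm_pos_iff]
  rw [pow_zero, mul_one, norm_add_eq_left_of_lt h1]
  simpa using hpos

theorem norm_eval_trunc_sub_le (hf : IsEntire f) {x : K} (hx : ‖x‖ ≤ r) {m : ℕ} {c : ℝ}
    (hc : 0 ≤ c) (h : ∀ k, m ≤ k → ‖coeff k f‖ * r ^ k ≤ c) :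
    ‖seriesEval f x - (trunc m f).eval x‖ ≤ c := by
  have hr : 0 ≤ r := (norm_nonneg x).trans hx
  rw [seriesEval, Polynomial.eval, eval₂_trunc_eq_sum_range,
    ← (hf.summable_eval x).sum_add_tsum_nat_add m]
  simp only [RingHom.id_apply]
  rw [add_sub_cancel_left]
  refine IsUltrametricDist.norm_tsum_le_of_forall_le_of_nonneg hc fun k => ?_
  rw [norm_mul, norm_pow]
  exact le_trans (by gcongr) (h (k + m) (by omega))

variable [IsAlgClosed K]

/-- An entire series, whose last dominant index `n` on the disc of radius `r` is positive, has a
zero near every point of that disc at which it is small. -/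
theorem IsLastDominant.exists_zero_near (hf : IsEntire f) (hr : 0 < r) (hn : 1 ≤ n)
    (h : IsLastDominant f r n) {x : K} (hx : ‖x‖ ≤ r) :
    ∃ ξ, seriesEval f ξ = 0 ∧ ‖ξ‖ ≤ r ∧ ‖coeff n f‖ * ‖ξ - x‖ ^ n ≤ ‖seriesEval f x‖ := by
  by_cases hfx : seriesEval f x = 0
  · exact ⟨x, hfx, hx, by simp [show n ≠ 0 by omega]⟩
  have hfx' : 0 < ‖seriesEval f x‖ := norm_pos_iff.2 hfx
  have hcpos : 0 < ‖coeff n f‖ := norm_pos_iff.2 (h.coeff_ne_zero hr.le)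
  obtain ⟨M₀, hM₀⟩ := ((hf r hr).eventually (gt_mem_nhds hfx')).exists_forall_of_atTop
  -- From M on the tail is at most ‖f(x)‖, so replacing f by a truncation does not enlarge the bound
  -- at x.
  obtain ⟨M, hMn, hM⟩ : ∃ M, n < M ∧ ∀ m, M ≤ m → ‖coeff m f‖ * r ^ m ≤ ‖seriesEval f x‖ :=
    ⟨M₀ + n + 1, by omega, fun m hm => (hM₀ m (by omega)).le⟩
  have step : ∀ m, n < m → ∀ y : K, ‖y‖ ≤ r → ∃ z, (PowerSeries.trunc m f).eval z = 0 ∧ ‖z‖ ≤ r ∧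
      ‖coeff n f‖ * ‖z - y‖ ^ n ≤ ‖(PowerSeries.trunc m f).eval y‖ := by
    intro m hm y hy
    have hd := h.trunc hr hm
    obtain ⟨z, hz, hzy⟩ := hd.exists_polynomial_root_near hr hn hy
    have hco : (PowerSeries.trunc m f).coeff n = coeff n f := by rw [coeff_trunc, if_pos hm]
    have hle := hd.norm_seriesEval_le hy
    rw [seriesEval_polynomial, Polynomial.coeff_coe, hco] at hle
    rw [hco] at hzy
    refine ⟨z, hz, ?_, hzy⟩
    -- The value at y is at most the dominant term, so the root is within r of y and stays in the
    -- disc.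
    have h1 : ‖z - y‖ ^ n ≤ r ^ n := le_of_mul_le_mul_left (hzy.trans hle) hcpos
    have h2 : ‖z - y‖ ≤ r := le_of_pow_le_pow_left₀ (by omega) hr.le h1
    simpa using norm_add_le_of_le' h2 hy
  choose! φ hφ0 hφr hφ using step
  -- Start from a root of the M-th truncation near x, then move each time to a nearby root of the
  -- next truncation.
  let y : ℕ → K := fun m => Nat.rec (φ M x) (fun m z => φ (M + m + 1) z) m
  have hy0 : y 0 = φ M x := rfl
  have hys : ∀ m, y (m + 1) = φ (M + m + 1) (y m) := fun m => rfl
  have hyr : ∀ m, ‖y m‖ ≤ r := by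
    intro m
    induction m with
    | zero => exact hφr M hMn x hx
    | succ m ih => exact hφr _ (by omega) _ ih
  have hyz : ∀ m, (PowerSeries.trunc (M + m) f).eval (y m) = 0 := by
    intro m
    rcases m with _ | m
    · exact hφ0 M hMn x hx
    · exact hφ0 _ (by omega) _ (hyr m)
  have hyd : ∀ m, ‖coeff n f‖ * ‖y (m + 1) - y m‖ ^ n ≤ ‖coeff (M + m) f‖ * r ^ (M + m) := by
    intro m
    refine (hφ (M + m + 1) (by omega) (y m) (hyr m)).trans ?_
    -- At a root of one truncation, the next truncation reduces to its single new term.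
    rw [trunc_succ, Polynomial.eval_add, hyz m, zero_add, Polynomial.eval_monomial, norm_mul,
      norm_pow]
    gcongr
    exact hyr m
  have hMshift : Tendsto (fun m => ‖coeff (M + m) f‖ * r ^ (M + m)) atTop (𝓝 0) := by
    simpa [add_comm] using (tendsto_add_atTop_iff_nat M).2 (hf r hr)
  have hcauchy : CauchySeq y := by
    refine NonarchimedeanAddGroup.cauchySeq_of_tendsto_sub_nhds_zero ?_
    rw [tendsto_zero_iff_norm_tendsto_zero]
    have h1 : Tendsto (fun m => ‖y (m + 1) - y m‖ ^ n) atTop (𝓝 0) := by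
      refine squeeze_zero (fun m => by positivity) (fun m => ?_)
        (by simpa using hMshift.const_mul ‖coeff n f‖⁻¹)
      rw [inv_mul_eq_div, le_div_iff₀' hcpos]
      exact hyd m
    rw [Metric.tendsto_atTop] at h1 ⊢
    intro ε hε
    obtain ⟨m₀, hm₀⟩ := h1 (ε ^ n) (by positivity)
    refine ⟨m₀, fun m hm => ?_⟩
    have h2 := hm₀ m hm
    rw [Real.dist_eq, sub_zero, abs_of_nonneg (by positivity)] at h2 ⊢
    exact lt_of_pow_lt_pow_left₀ n hε.le h2
  obtain ⟨ξ, hξ⟩ := cauchySeq_tendsto_of_complete hcauchy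
  refine ⟨ξ, ?_, le_of_tendsto hξ.norm (Eventually.of_forall hyr), ?_⟩
  · have h1 : Tendsto (fun m => seriesEval f (y m)) atTop (𝓝 (seriesEval f ξ)) :=
      (hf.continuous.tendsto ξ).comp hξ
    refine tendsto_nhds_unique h1 ?_
    rw [tendsto_zero_iff_norm_tendsto_zero, Metric.tendsto_atTop]
    intro ε hε
    obtain ⟨m₀, hm₀⟩ := (hMshift.eventually (gt_mem_nhds (half_pos hε))).exists_forall_of_atTop
    refine ⟨m₀, fun m hm => ?_⟩
    rw [Real.dist_eq, sub_zero, abs_of_nonneg (by positivity)]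
    have h2 := norm_eval_trunc_sub_le hf (hyr m) (m := M + m) (half_pos hε).le (fun k hk => by
      obtain ⟨j, rfl⟩ := Nat.exists_eq_add_of_le (show M ≤ k by omega)
      exact (hm₀ j (by omega)).le)
    rw [hyz m, sub_zero] at h2
    linarith
  -- The first step and all later increments obey the same bound, so by the ultrametric inequality
  -- their sums do too.
  · have h1 : ∀ m, ‖coeff n f‖ * ‖y m - x‖ ^ n ≤ ‖seriesEval f x‖ := by
      intro m
      induction m with
      | zero =>
        refine (hφ M hMn x hx).trans ?_
        have h2 := norm_eval_trunc_sub_le hf hx (m := M) hfx'.le hM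
        have h3 := norm_sub_le_of_le' (le_refl ‖seriesEval f x‖) h2
        simpa using h3
      | succ m ih =>
        have h2 := (hyd m).trans (hM (M + m) (by omega))
        have h3 : y (m + 1) - x = (y (m + 1) - y m) + (y m - x) := by ring
        rcases le_total ‖y (m + 1) - y m‖ ‖y m - x‖ with h4 | h4
        · refine le_trans ?_ ih
          gcongr
          rw [h3]; exact norm_add_le_of_le' h4 le_rfl
        · refine le_trans ?_ h2
          gcongr
          rw [h3]; exact norm_add_le_of_le' le_rfl h4
    exact le_of_tendsto ((((hξ.sub_const x).norm).pow n).const_mul _) (Eventually.of_forall h1)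

end Roots

/-! ### Dividing a series by a linear factor -/

section Division

variable {K : Type*} [NormedField K]

/-- The quotient of `f` by `X - ρ`, when `ρ` is a zero of `f`. -/
noncomputable def divXSub (f : PowerSeries K) (ρ : K) : PowerSeries K :=
  PowerSeries.mk fun k => ∑' n, coeff (n + (k + 1)) f * ρ ^ n

theorem IsEntire.summable_shift [CompleteSpace K] {f : PowerSeries K} (hf : IsEntire f) (ρ : K)
    (k : ℕ) : Summable fun n => coeff (n + k) f * ρ ^ n := by
  have h1 : (1 : ℝ) ≤ ‖ρ‖ + 1 := by linarith [norm_nonneg ρ]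
  refine Summable.of_norm_bounded
    ((summable_nat_add_iff k).2 (hf.summable (by positivity : 0 ≤ ‖ρ‖ + 1))) fun n => ?_
  rw [norm_mul, norm_pow]
  gcongr
  calc ‖ρ‖ ^ n ≤ (‖ρ‖ + 1) ^ n := by gcongr; linarith
    _ ≤ (‖ρ‖ + 1) ^ (n + k) := pow_le_pow_right₀ h1 (by omega)

theorem coeff_divXSub [CompleteSpace K] {f : PowerSeries K} (hf : IsEntire f) (ρ : K) (k : ℕ) :
    coeff k (divXSub f ρ) = coeff (k + 1) f + ρ * coeff (k + 1) (divXSub f ρ) := by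
  rw [divXSub, coeff_mk, coeff_mk, (hf.summable_shift ρ (k + 1)).tsum_eq_zero_add, ← tsum_mul_left]
  congr 1
  · simp
  · refine tsum_congr fun n => ?_
    rw [pow_succ, show n + 1 + (k + 1) = n + (k + 1 + 1) by ring]; ring

theorem X_sub_C_mul_divXSub [CompleteSpace K] {f : PowerSeries K} (hf : IsEntire f) {ρ : K}
    (hρ : seriesEval f ρ = 0) : (X - C ρ) * divXSub f ρ = f := by
  ext k
  rcases k with _ | k
  · rw [sub_mul, map_sub, coeff_zero_X_mul, coeff_C_mul, divXSub, coeff_mk, ← tsum_mul_left]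
    rw [seriesEval, (hf.summable_eval ρ).tsum_eq_zero_add] at hρ
    rw [pow_zero, mul_one] at hρ
    rw [zero_sub, neg_eq_iff_eq_neg, ← eq_neg_of_add_eq_zero_right hρ]
    refine tsum_congr fun n => ?_
    rw [pow_succ, zero_add]; ring
  · rw [sub_mul, map_sub, coeff_succ_X_mul, coeff_C_mul, coeff_divXSub hf]; ring

variable [IsUltrametricDist K]

theorem norm_coeff_divXSub_mul_pow_le {f : PowerSeries K} {ρ : K} {r c : ℝ} (hr : 0 < r)
    (hρ : ‖ρ‖ ≤ r) {k : ℕ} (hc : ∀ n, k < n → ‖coeff n f‖ * r ^ n ≤ c) :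
    ‖coeff k (divXSub f ρ)‖ * r ^ (k + 1) ≤ c := by
  have hc0 : 0 ≤ c := le_trans (by positivity) (hc (k + 1) (by omega))
  rw [← le_div_iff₀ (by positivity), divXSub, coeff_mk]
  refine IsUltrametricDist.norm_tsum_le_of_forall_le_of_nonneg (by positivity) fun n => ?_
  rw [le_div_iff₀ (by positivity), norm_mul, norm_pow]
  calc ‖coeff (n + (k + 1)) f‖ * ‖ρ‖ ^ n * r ^ (k + 1) ≤
      ‖coeff (n + (k + 1)) f‖ * r ^ n * r ^ (k + 1) := by gcongr
    _ = ‖coeff (n + (k + 1)) f‖ * r ^ (n + (k + 1)) := by rw [pow_add]; ring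
    _ ≤ c := hc _ (by omega)

theorem norm_coeff_divXSub_mul_pow_lt {f : PowerSeries K} (hf : IsEntire f) {ρ : K} {r c : ℝ}
    (hr : 0 < r) (hρ : ‖ρ‖ ≤ r) {k : ℕ} (hc : ∀ n, k < n → ‖coeff n f‖ * r ^ n < c) :
    ‖coeff k (divXSub f ρ)‖ * r ^ (k + 1) < c := by
  have hc0 : 0 < c := lt_of_le_of_lt (by positivity) (hc (k + 1) (by omega))
  obtain ⟨d, -, hdc, hd⟩ := exists_lt_forall_le_of_tendsto_zero
    ((tendsto_add_atTop_iff_nat (k + 1)).2 (hf r hr)) hc0 fun n => hc _ (by omega)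
  refine lt_of_le_of_lt (norm_coeff_divXSub_mul_pow_le hr hρ fun n hn => ?_) hdc
  obtain ⟨j, rfl⟩ := Nat.exists_eq_add_of_le (show k + 1 ≤ n by omega)
  rw [add_comm (k + 1)]; exact hd j

theorem IsEntire.divXSub {f : PowerSeries K} (hf : IsEntire f) (ρ : K) :
    IsEntire (divXSub f ρ) := by
  refine isEntire_of_bounded fun r hr => ?_
  obtain ⟨C, -, hC⟩ := hf.bounded (r := max r ‖ρ‖) (le_max_of_le_left (by linarith))
  refine ⟨C, fun n => le_trans ?_ (norm_coeff_divXSub_mul_pow_le (k := n) (ρ := ρ)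
    (lt_max_of_lt_left (by linarith : 0 < r)) (le_max_right _ _) fun n _ => hC n)⟩
  gcongr
  calc r ^ n ≤ max r ‖ρ‖ ^ n := by gcongr; exact le_max_left _ _
    _ ≤ _ := pow_le_pow_right₀ (le_max_of_le_left hr.le) (by omega)

/-- The k-th coefficient of the quotient involves only coefficients of f beyond k, and its n-th one
is that of f at n + 1 plus a smaller term. Thus the dominant index drops by one, the measure for the
later inductions. -/
theorem IsLastDominant.divXSub [CompleteSpace K] {f : PowerSeries K} (hf : IsEntire f) {ρ : K}
    {r : ℝ} (hr : 0 < r) (hρ : ‖ρ‖ ≤ r) {n : ℕ} (h : IsLastDominant f r (n + 1)) :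
    IsLastDominant (divXSub f ρ) r n := by
  have hle : ∀ k, ‖coeff k (PadicFactorization.divXSub f ρ)‖ * r ^ (k + 1) ≤
      ‖coeff (n + 1) f‖ * r ^ (n + 1) :=
    fun k => norm_coeff_divXSub_mul_pow_le hr hρ fun j _ => h.le j
  have hlt : ∀ k, n < k → ‖coeff k (PadicFactorization.divXSub f ρ)‖ * r ^ (k + 1) <
      ‖coeff (n + 1) f‖ * r ^ (n + 1) :=
    fun k hk => norm_coeff_divXSub_mul_pow_lt hf hr hρ fun j hj => h.lt j (by omega)
  have heq : ‖coeff n (PadicFactorization.divXSub f ρ)‖ = ‖coeff (n + 1) f‖ := by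
    rw [coeff_divXSub hf]
    refine norm_add_eq_left_of_lt ?_
    have h1 := hlt (n + 1) (by omega)
    rw [pow_succ r (n + 1), mul_comm (r ^ (n + 1)), ← mul_assoc] at h1
    refine lt_of_le_of_lt ?_ (lt_of_mul_lt_mul_right h1 (by positivity))
    rw [norm_mul, mul_comm]
    gcongr
  refine ⟨fun k => ?_, fun k hk => ?_⟩
  · have h1 := hle k
    rw [← heq, pow_succ, pow_succ, ← mul_assoc, ← mul_assoc] at h1
    exact le_of_mul_le_mul_right h1 hr
  · have h1 := hlt k hk
    rw [← heq, pow_succ, pow_succ, ← mul_assoc, ← mul_assoc] at h1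
    exact lt_of_mul_lt_mul_right h1 hr.le

end Division

/-! ### Factoring out zeros, and quotients without poles -/

section Factorization

variable {K : Type*} [NormedField K] [IsUltrametricDist K] [CompleteSpace K] [IsAlgClosed K]

theorem exists_zero_of_norm_coeff_zero_le {f : PowerSeries K} (hf : IsEntire f) {r : ℝ}
    (hr : 0 < r) {k : ℕ} (hk : 1 ≤ k) (hk0 : coeff k f ≠ 0)
    (hle : ‖coeff 0 f‖ ≤ ‖coeff k f‖ * r ^ k) : ∃ x, seriesEval f x = 0 ∧ ‖x‖ ≤ r := by
  obtain ⟨n, hn⟩ := hf.exists_isLastDominant (by rintro rfl; simp at hk0) hr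
  obtain ⟨x, hx, hxr, -⟩ := hn.exists_zero_near hf hr (hn.one_le hk hle)
    (x := 0) (by simpa using hr.le)
  exact ⟨x, hx, hxr⟩

omit [IsUltrametricDist K] [CompleteSpace K] [IsAlgClosed K] in
theorem eventually_lt_norm_mul_pow {c : K} (hc : c ≠ 0) {k : ℕ} (hk : 1 ≤ k) (b : ℝ) :
    ∀ᶠ r : ℝ in atTop, b < ‖c‖ * r ^ k :=
  ((tendsto_pow_atTop (by omega)).const_mul_atTop (norm_pos_iff.2 hc)).eventually_gt_atTop b

/-- A nonconstant entire series has a zero. -/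
theorem IsEntire.exists_zero {f : PowerSeries K} (hf : IsEntire f) {k : ℕ} (hk : 1 ≤ k)
    (hk0 : coeff k f ≠ 0) : ∃ x, seriesEval f x = 0 := by
  obtain ⟨r, h1, h2⟩ := ((eventually_lt_norm_mul_pow hk0 hk ‖coeff 0 f‖).and
    (eventually_gt_atTop 0)).exists
  obtain ⟨x, hx, -⟩ := exists_zero_of_norm_coeff_zero_le hf h2 hk hk0 h1.le
  exact ⟨x, hx⟩

/-- While the dominant index is positive there is a zero in the disc; dividing it out lowers the
index until the constant term dominates strictly. -/
theorem IsLastDominant.exists_eq_polynomial_mul {f : PowerSeries K} (hf : IsEntire f) {r : ℝ}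
    (hr : 0 < r) {n : ℕ} (h : IsLastDominant f r n) : ∃ (P : Polynomial K) (U : PowerSeries K),
      P ≠ 0 ∧ IsEntire U ∧ IsLastDominant U r 0 ∧ f = P * U := by
  induction n generalizing f with
  | zero => exact ⟨1, f, one_ne_zero, hf, h, by simp⟩
  | succ n ih =>
    obtain ⟨ρ, hρ, hρr, -⟩ := h.exists_zero_near hf hr (by omega) (x := 0) (by simpa using hr.le)
    obtain ⟨P, U, hP, hU, hUd, he⟩ := ih (hf.divXSub ρ) (h.divXSub hf hr hρr)
    refine ⟨(Polynomial.X - Polynomial.C ρ) * P, U, mul_ne_zero (Polynomial.X_sub_C_ne_zero ρ) hP,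
      hU, hUd, ?_⟩
    rw [← X_sub_C_mul_divXSub hf hρ, he, Polynomial.coe_mul, Polynomial.coe_sub, Polynomial.coe_X,
      Polynomial.coe_C, mul_assoc]

/-- A nonzero entire series is, on each disc, a polynomial times a series without zeros. -/
theorem IsEntire.exists_eq_polynomial_mul {f : PowerSeries K} (hf : IsEntire f) (h0 : f ≠ 0)
    {r : ℝ} (hr : 0 < r) : ∃ (P : Polynomial K) (U : PowerSeries K),
      P ≠ 0 ∧ IsEntire U ∧ IsLastDominant U r 0 ∧ f = P * U := by
  obtain ⟨n, hn⟩ := hf.exists_isLastDominant h0 hr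
  exact hn.exists_eq_polynomial_mul hf hr

theorem IsEntire.finite_zeros {f : PowerSeries K} (hf : IsEntire f) (h0 : f ≠ 0) (r : ℝ) :
    {x | ‖x‖ ≤ r ∧ seriesEval f x = 0}.Finite := by
  classical
  obtain ⟨P, U, hP, hU, hUd, rfl⟩ := hf.exists_eq_polynomial_mul h0
    (lt_max_of_lt_right one_pos : 0 < max r 1)
  refine P.roots.toFinset.finite_toSet.subset fun x hx => ?_
  have h1 := hUd.seriesEval_ne_zero hU (hx.1.trans (le_max_left _ _))
  have h2 := hx.2
  rw [seriesEval_mul (isEntire_polynomial P) hU, seriesEval_polynomial] at h2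
  simpa [hP] using (mul_eq_zero.1 h2).resolve_right h1

/-- An entire series that is not a polynomial has arbitrarily large zeros. -/
theorem IsEntire.exists_zero_norm_gt {f : PowerSeries K} (hf : IsEntire f)
    (hpoly : ¬ ∃ P : Polynomial K, f = P) (R : ℝ) : ∃ x, R < ‖x‖ ∧ seriesEval f x = 0 := by
  have h0 : f ≠ 0 := fun h => hpoly ⟨0, by simp [h]⟩
  obtain ⟨P, U, -, hU, hUd, rfl⟩ := hf.exists_eq_polynomial_mul h0
    (lt_max_of_lt_right one_pos : 0 < max R 1)
  obtain ⟨k, hk, hk0⟩ : ∃ k, 1 ≤ k ∧ coeff k U ≠ 0 := by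
    -- If U were constant, the product would be a polynomial.
    by_contra! hc
    refine hpoly ⟨P * Polynomial.C (coeff 0 U), ?_⟩
    rw [Polynomial.coe_mul, Polynomial.coe_C]
    congr 1
    ext k
    rcases k with _ | k
    · simp
    · rw [hc (k + 1) (by omega), coeff_C, if_neg (by omega)]
  obtain ⟨y, hy⟩ := hU.exists_zero hk hk0
  refine ⟨y, ?_, by rw [seriesEval_mul (isEntire_polynomial P) hU, hy, mul_zero]⟩
  by_contra! hle
  exact hUd.seriesEval_ne_zero hU (hle.trans (le_max_left _ _)) hy

/-- The last hypothesis says that A / B is regular everywhere. A zero of B in the disc is then a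
zero of A, and both can be divided by the linear factor. Once the constant term of B dominates, the
recursion for the coefficients of A / B gives the bound. -/
theorem exists_quotient_bounded {A B : PowerSeries K} (hA : IsEntire A) (hB : IsEntire B) {r : ℝ}
    (hr : 0 < r) {n : ℕ} (hn : IsLastDominant B r n)
    (h : ∀ x, ∃ a b, IsEntire a ∧ IsEntire b ∧ seriesEval b x ≠ 0 ∧ a * B = A * b) :
    ∃ Q, A = B * Q ∧ ∃ C, ∀ k, ‖coeff k Q‖ * r ^ k ≤ C := by
  induction n generalizing A B with
  | zero =>
    have hB0 : coeff 0 B ≠ 0 := hn.coeff_ne_zero hr.le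
    have hB0' : 0 < ‖coeff 0 B‖ := norm_pos_iff.2 hB0
    have hBQ : B * (A * B⁻¹) = A := by
      rw [mul_left_comm, PowerSeries.mul_inv_cancel _ (by simpa using hB0), mul_one]
    obtain ⟨C, -, hC⟩ := hA.bounded hr.le
    refine ⟨A * B⁻¹, hBQ.symm, C / ‖coeff 0 B‖, fun k => ?_⟩
    set Q := A * B⁻¹
    induction k using Nat.strong_induction_on with
    | _ k ih =>
      rw [le_div_iff₀ hB0']
      have h1 : coeff k A = coeff 0 B * coeff k Q +
          ∑ i ∈ Finset.range k, coeff (i + 1) B * coeff (k - (i + 1)) Q := by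
        rw [← hBQ, coeff_mul, Finset.Nat.sum_antidiagonal_eq_sum_range_succ
          (fun i j => coeff i B * coeff j Q), Finset.sum_range_succ', add_comm]
        simp
      have h2 : coeff 0 B * coeff k Q = coeff k A -
          ∑ i ∈ Finset.range k, coeff (i + 1) B * coeff (k - (i + 1)) Q := by rw [h1]; ring
      have h3 : ‖coeff 0 B * coeff k Q‖ ≤ C / r ^ k := by
        rw [h2]
        have hC0 : 0 ≤ C := le_trans (by positivity) (hC 0)
        refine norm_sub_le_of_le' (by rw [le_div_iff₀ (by positivity)]; exact hC k) ?_
        refine IsUltrametricDist.norm_sum_le_of_forall_le_of_nonneg (by positivity) fun i hi => ?_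
        have hi' : i < k := Finset.mem_range.1 hi
        rw [le_div_iff₀ (by positivity), norm_mul]
        have h4 := ih (k - (i + 1)) (by omega)
        have h5 := hn.le (i + 1)
        rw [pow_zero, mul_one] at h5
        calc ‖coeff (i + 1) B‖ * ‖coeff (k - (i + 1)) Q‖ * r ^ k
            = (‖coeff (i + 1) B‖ * r ^ (i + 1)) *
              (‖coeff (k - (i + 1)) Q‖ * r ^ (k - (i + 1))) := by
              rw [show r ^ k = r ^ (i + 1) * r ^ (k - (i + 1)) by rw [← pow_add]; congr 1; omega]
              ring
          _ ≤ ‖coeff 0 B‖ * (C / ‖coeff 0 B‖) := by gcongr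
          _ = C := by field_simp
      rw [norm_mul, le_div_iff₀ (by positivity)] at h3
      linarith
  | succ n ih =>
    obtain ⟨ρ, hρ, hρr, -⟩ := hn.exists_zero_near hB hr (by omega) (x := 0) (by simpa using hr.le)
    have hAρ : seriesEval A ρ = 0 := by
      obtain ⟨a, b, ha, hb, hbρ, he⟩ := h ρ
      have h1 := congrArg (fun g => seriesEval g ρ) he
      simp only [seriesEval_mul ha hB, seriesEval_mul hA hb, hρ, mul_zero] at h1
      exact (mul_eq_zero.1 h1.symm).resolve_right hbρ
    have hXC : (X - C ρ : PowerSeries K) ≠ 0 := by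
      intro h0
      have := congrArg (coeff 1) h0
      simp at this
    obtain ⟨Q, hQ, hC⟩ := ih (hA.divXSub ρ) (hB.divXSub ρ) (hn.divXSub hB hr hρr) fun x => by
      obtain ⟨a, b, ha, hb, hbx, he⟩ := h x
      refine ⟨a, b, ha, hb, hbx, mul_left_cancel₀ hXC ?_⟩
      rw [mul_left_comm, X_sub_C_mul_divXSub hB hρ, ← mul_assoc, X_sub_C_mul_divXSub hA hAρ, he]
    refine ⟨Q, ?_, hC⟩
    rw [← X_sub_C_mul_divXSub hA hAρ, hQ, ← mul_assoc, X_sub_C_mul_divXSub hB hρ]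

/-- If the quotient `A / B` of entire series has no pole, then it is entire. -/
theorem IsEntire.exists_eq_mul {A B : PowerSeries K} (hA : IsEntire A) (hB : IsEntire B)
    (hB0 : B ≠ 0)
    (h : ∀ x, ∃ a b, IsEntire a ∧ IsEntire b ∧ seriesEval b x ≠ 0 ∧ a * B = A * b) :
    ∃ Q, IsEntire Q ∧ A = B * Q := by
  have key : ∀ r : ℝ, 0 < r → ∃ Q, A = B * Q ∧ ∃ C, ∀ k, ‖coeff k Q‖ * r ^ k ≤ C := by
    intro r hr
    obtain ⟨n, hn⟩ := hB.exists_isLastDominant hB0 hr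
    exact exists_quotient_bounded hA hB hr hn h
  obtain ⟨Q, hQ, -⟩ := key 1 one_pos
  refine ⟨Q, isEntire_of_bounded fun r hr => ?_, hQ⟩
  -- The quotient is unique as a formal series, so the bounds obtained on different discs concern
  -- the same Q.
  obtain ⟨Q', hQ', hC⟩ := key r (by linarith)
  rwa [mul_left_cancel₀ hB0 (hQ.symm.trans hQ')]

end Factorization

/-! ### Divided differences on large circles -/

section Slope

variable {K : Type*} [NormedField K]

/-- The divided difference `(f(x) - f(y)) / (x - y)` of the series `f`, as a series in `x`, `y`. -/
noncomputable def seriesSlope (f : PowerSeries K) (x y : K) : K :=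
  ∑' n, coeff n f * ∑ i ∈ Finset.range n, x ^ i * y ^ (n - 1 - i)

theorem norm_geom_sum₂_mul_le [IsUltrametricDist K] {x y : K} {r : ℝ} (hx : ‖x‖ ≤ r)
    (hy : ‖y‖ ≤ r) (n : ℕ) :
    ‖∑ i ∈ Finset.range n, x ^ i * y ^ (n - 1 - i)‖ * r ≤ r ^ n := by
  have hr : 0 ≤ r := (norm_nonneg x).trans hx
  rcases n with _ | n
  · simp
  · rw [pow_succ]
    refine mul_le_mul_of_nonneg_right ?_ hr
    refine IsUltrametricDist.norm_sum_le_of_forall_le_of_nonneg (by positivity) fun i hi => ?_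
    have hi' := Finset.mem_range.1 hi
    rw [norm_mul, norm_pow, norm_pow]
    calc ‖x‖ ^ i * ‖y‖ ^ (n + 1 - 1 - i) ≤ r ^ i * r ^ (n + 1 - 1 - i) := by gcongr
      _ = r ^ n := by rw [← pow_add]; congr 1; omega

theorem norm_slope_term_le [IsUltrametricDist K] (f : PowerSeries K) {x y : K} {r : ℝ} (hr : 1 ≤ r)
    (hx : ‖x‖ ≤ r) (hy : ‖y‖ ≤ r) (n : ℕ) :
    ‖coeff n f * ∑ i ∈ Finset.range n, x ^ i * y ^ (n - 1 - i)‖ ≤ ‖coeff n f‖ * r ^ n := by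
  rw [norm_mul]
  gcongr
  exact (le_mul_of_one_le_right (norm_nonneg _) hr).trans (norm_geom_sum₂_mul_le hx hy n)

variable [IsUltrametricDist K] [CompleteSpace K] {f : PowerSeries K}

theorem IsEntire.summable_slope (hf : IsEntire f) (x y : K) :
    Summable fun n => coeff n f * ∑ i ∈ Finset.range n, x ^ i * y ^ (n - 1 - i) :=
  Summable.of_norm_bounded (hf.summable (r := max 1 (max ‖x‖ ‖y‖)) (by positivity)) fun n =>
    norm_slope_term_le f (le_max_left _ _) (by simp) (by simp) n

theorem seriesSlope_mul_sub (hf : IsEntire f) (x y : K) :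
    seriesSlope f x y * (x - y) = seriesEval f x - seriesEval f y := by
  rw [seriesSlope, seriesEval, seriesEval, ← (hf.summable_eval x).tsum_sub (hf.summable_eval y),
    ← tsum_mul_right]
  refine tsum_congr fun n => ?_
  rw [mul_assoc, Commute.geom_sum₂_mul (Commute.all x y), mul_sub]

theorem IsEntire.continuousAt_slope (hf : IsEntire f) (y : K) :
    ContinuousAt (fun x => seriesSlope f x y) y := by
  have hy : Metric.ball (0 : K) (‖y‖ + 1) ∈ 𝓝 y := Metric.isOpen_ball.mem_nhds (by simp)
  refine ContinuousOn.continuousAt (s := Metric.ball 0 (‖y‖ + 1)) ?_ hy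
  refine continuousOn_tsum (fun n => by fun_prop)
    (hf.summable (by positivity : (0 : ℝ) ≤ ‖y‖ + 1)) fun n x hx => ?_
  exact norm_slope_term_le f (by simp) (mem_ball_zero_iff.1 hx).le (by simp) n

/-- The heart of the proof. Taking x ≠ y gives injectivity on the fibre over β in a large circle;
taking x = y gives a nonvanishing derivative. -/
theorem exists_forall_seriesSlope_ne_zero (hf : IsEntire f) {n₀ : ℕ}
    (hne : ∀ n ≥ n₀, coeff n f ≠ 0)
    (hmono : StrictMonoOn (fun n : ℕ => ‖coeff n f / coeff (n + 1) f‖) (Set.Ici n₀))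
    (hunb : ¬ BddAbove ((fun n : ℕ => ‖coeff n f / coeff (n + 1) f‖) '' Set.Ici n₀)) (β : K) :
    ∃ R : ℝ, ∀ x y : K, R ≤ ‖x‖ → ‖x‖ = ‖y‖ → seriesEval f x = β → seriesEval f y = β →
      seriesSlope f x y ≠ 0 := by
  set c : ℕ → K := fun n => coeff n f with hc
  set q : ℕ → ℝ := fun n => ‖c n / c (n + 1)‖ with hq
  -- The shift ensures m ≥ 1, so that ‖c m‖ * r ^ m outgrows ‖β‖.
  set m := n₀ + 1 with hm
  have hcm : ∀ n ≥ m, 0 < ‖c n‖ := fun n hn => norm_pos_iff.2 (hne n (by omega))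
  obtain ⟨R, hR⟩ : ∃ R : ℝ, ∀ r, R ≤ r → 0 < r ∧ q m < r ∧ ‖β‖ < ‖c m‖ * r ^ m ∧
      ∀ k ∈ Finset.range m, ‖c k‖ * r ^ k < ‖c m‖ * r ^ m := by
    refine eventually_atTop.1 ?_
    refine (eventually_gt_atTop 0).and ((eventually_gt_atTop _).and
      ((eventually_lt_norm_mul_pow (norm_pos_iff.1 (hcm m le_rfl)) (by omega) _).and
      ((Finset.eventually_all _).2 fun k hk => ?_)))
    have hk' := Finset.mem_range.1 hk
    filter_upwards [eventually_gt_atTop 0, eventually_lt_norm_mul_pow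
      (norm_pos_iff.1 (hcm m le_rfl)) (show 1 ≤ m - k by omega) ‖c k‖] with r hr0 hr
    rw [show r ^ m = r ^ (m - k) * r ^ k by rw [← pow_add]; congr 1; omega, ← mul_assoc]
    gcongr
  refine ⟨R, fun x y hRx hxy hfx hfy => ?_⟩
  obtain ⟨r, hxr⟩ : ∃ r, ‖x‖ = r := ⟨_, rfl⟩
  have hyr : ‖y‖ = r := hxy ▸ hxr
  obtain ⟨hr0, hqr, hβ, hlow⟩ := hR r (hxr ▸ hRx)
  set t : ℕ → ℝ := fun k => ‖c k‖ * r ^ k with ht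
  have hex : ∃ n, m ≤ n ∧ r ≤ q n := by
    by_contra! hno
    refine hunb ⟨max r (q n₀), ?_⟩
    rintro _ ⟨n, hn, rfl⟩
    rcases eq_or_lt_of_le (Set.mem_Ici.1 hn) with rfl | hn'
    · exact le_max_right _ _
    · exact le_max_of_le_left (hno n (by omega)).le
  classical
  -- As t j / t (j + 1) = q j / r, the first n with r ≤ q n is the turning point: t rises strictly
  -- up to n, does not rise from n to n + 1, and falls strictly afterwards.
  obtain ⟨n, ⟨hmn, hrn⟩, hmin⟩ : ∃ n, (m ≤ n ∧ r ≤ q n) ∧ ∀ j < n, m ≤ j → q j < r :=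
    ⟨Nat.find hex, Nat.find_spec hex, fun j hj hmj => by
      have := Nat.find_min hex hj; push Not at this; exact this hmj⟩
  have htq : ∀ j ≥ m, t j * r = q j * t (j + 1) := by
    intro j hj
    have := (hcm (j + 1) (by omega)).ne'
    simp only [ht, hq, norm_div]
    field_simp
    ring
  have htpos : ∀ j ≥ m, 0 < t j := fun j hj => mul_pos (hcm j hj) (by positivity)
  have hup : ∀ j, m ≤ j → j < n → t j < t (j + 1) := by
    intro j hj hjn
    have h1 := htq j hj
    have h2 := mul_lt_mul_of_pos_right (hmin j hjn hj) (htpos (j + 1) (by omega))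
    exact lt_of_mul_lt_mul_right (by rw [h1, mul_comm _ r]; exact h2) hr0.le
  have hdown : ∀ j, n < j → t (j + 1) < t j := by
    intro j hj
    have h1 := htq j (by omega)
    have h3 : q n < q j := hmono (Set.mem_Ici.2 (by omega)) (Set.mem_Ici.2 (by omega)) hj
    have h2 := mul_lt_mul_of_pos_right (hrn.trans_lt h3) (htpos (j + 1) (by omega))
    exact lt_of_mul_lt_mul_right (by rw [h1, mul_comm _ r]; exact h2) hr0.le
  have hnn : t (n + 1) ≤ t n := by
    have h2 := mul_le_mul_of_nonneg_right hrn (htpos (n + 1) (by omega)).le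
    exact le_of_mul_le_mul_right (by rw [htq n hmn, mul_comm _ r]; exact h2) hr0
  have hmt : ∀ j, m ≤ j → j ≤ n → t j ≤ t n ∧ (j ≠ n → t j < t n) := by
    intro j hj hjn
    induction hjn using Nat.decreasingInduction with
    | self => simp
    | of_succ k hk ih =>
      have h1 := (hup k hj hk).trans_le (ih (by omega)).1
      exact ⟨h1.le, fun _ => h1⟩
  have hgt : ∀ i, t (n + 2 + i) < t (n + 1) := by
    intro i
    induction i with
    | zero => exact hdown (n + 1) (by omega)
    | succ i ih => exact (hdown (n + 2 + i) (by omega)).trans ih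
  have hlt : ∀ k, k ∉ ({n, n + 1} : Finset ℕ) → t k < t n := by
    intro k hk
    simp only [Finset.mem_insert, Finset.mem_singleton, not_or] at hk
    rcases lt_or_ge k m with h1 | h1
    · exact (hlow k (Finset.mem_range.2 h1)).trans_le (hmt m le_rfl hmn).1
    · rcases lt_or_gt_of_ne hk.1 with h2 | h2
      · exact (hmt k h1 h2.le).2 h2.ne
      · obtain ⟨i, rfl⟩ := Nat.exists_eq_add_of_le (show n + 2 ≤ k by omega)
        exact (hgt i).trans_le hnn
  have htn := htpos n hmn
  -- the sum of a series whose terms off `n`, `n + 1` are small is close to those two terms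
  have hrest : ∀ (u : ℕ → K) (d : ℝ), 0 < d → Summable u →
      (∀ k, k ∉ ({n, n + 1} : Finset ℕ) → ‖u k‖ < d) → ‖∑' k, u k - (u n + u (n + 1))‖ < d := by
    intro u d hd hu hud
    have h1 : u n + u (n + 1) = ∑' k, if k ∈ ({n, n + 1} : Finset ℕ) then u k else 0 := by
      rw [tsum_eq_sum (s := {n, n + 1}) (fun k hk => if_neg hk),
        Finset.sum_pair (by omega)]
      simp
    have h2 : Summable fun k => if k ∈ ({n, n + 1} : Finset ℕ) then u k else 0 :=
      summable_of_ne_finset_zero (s := {n, n + 1}) fun k hk => if_neg hk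
    rw [h1, ← hu.tsum_sub h2]
    refine norm_tsum_lt_of_forall_lt (by simpa using (hu.sub h2).tendsto_atTop_zero.norm) hd
      fun k => ?_
    by_cases hk : k ∈ ({n, n + 1} : Finset ℕ)
    · simpa [hk] using hd
    · simpa [hk] using hud k hk
  -- Both β and the remaining terms are smaller than t n, so the two leading terms must cancel to
  -- first order.
  have hpair : ‖c n + c (n + 1) * y‖ < ‖c n‖ := by
    have h1 := hrest (fun k => c k * y ^ k) (t n) htn (hf.summable_eval y) fun k hk => by
      rw [norm_mul, norm_pow, hyr]; exact hlt k hk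
    have h2 : ∑' k, c k * y ^ k = β := hfy
    rw [h2] at h1
    have h3 : ‖c n * y ^ n + c (n + 1) * y ^ (n + 1)‖ < t n := by
      have := norm_sub_lt_of_lt (hβ.trans_le (hmt m le_rfl hmn).1) h1
      rwa [sub_sub_cancel] at this
    have h4 : c n * y ^ n + c (n + 1) * y ^ (n + 1) = (c n + c (n + 1) * y) * y ^ n := by ring
    rw [h4, norm_mul, norm_pow, hyr] at h3
    exact lt_of_mul_lt_mul_right h3 (by positivity)
  have hcy : ‖c (n + 1)‖ * r = ‖c n‖ := by
    have h1 : c (n + 1) * y = (c n + c (n + 1) * y) - c n := by ring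
    rw [← hyr, ← norm_mul, h1, norm_sub_rev, norm_sub_eq_left_of_lt hpair]
  set S : ℕ → K := fun k => ∑ i ∈ Finset.range k, x ^ i * y ^ (k - 1 - i) with hS
  have hSle : ∀ k, ‖S k‖ * r ≤ r ^ k := fun k => norm_geom_sum₂_mul_le hxr.le hyr.le k
  have hslope := hrest (fun k => c k * S k) (t n / r) (by positivity) (hf.summable_slope x y)
    fun k hk => by
      rw [lt_div_iff₀ hr0, norm_mul, mul_assoc]
      exact lt_of_le_of_lt (mul_le_mul_of_nonneg_left (hSle k) (norm_nonneg _)) (hlt k hk)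
  -- This regroups the two leading terms of the slope so that the small factor c n + c (n + 1) * y
  -- appears; what is left is c (n + 1) * x ^ n, of norm exactly t n / r.
  have hS1 : S (n + 1) = x ^ n + y * S n := by
    simp only [hS]
    rw [add_tsub_cancel_right, Commute.geom_sum₂_succ_eq (Commute.all x y)]
  have hsum : c n * S n + c (n + 1) * S (n + 1) =
      c (n + 1) * x ^ n + (c n + c (n + 1) * y) * S n := by rw [hS1]; ring
  have hmain : ‖c (n + 1) * x ^ n‖ = t n / r := by
    rw [eq_div_iff hr0.ne', norm_mul, norm_pow, hxr]
    calc _ = ‖c (n + 1)‖ * r * r ^ n := by ring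
      _ = t n := by rw [hcy]
  have hsmall : ‖(c n + c (n + 1) * y) * S n‖ < t n / r := by
    rw [lt_div_iff₀ hr0, norm_mul, mul_assoc]
    calc _ ≤ ‖c n + c (n + 1) * y‖ * r ^ n := by gcongr; exact hSle n
      _ < ‖c n‖ * r ^ n := mul_lt_mul_of_pos_right hpair (by positivity)
  intro h0
  have h1 : ∑' k, c k * S k = 0 := h0
  rw [h1, zero_sub, norm_neg, hsum, norm_add_eq_left_of_lt (by rwa [hmain]), hmain] at hslope
  exact lt_irrefl _ hslope

end Slope

theorem IsEntire.hasDerivAt {K : Type*} [NontriviallyNormedField K] [IsUltrametricDist K]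
    [CompleteSpace K] {f : PowerSeries K} (hf : IsEntire f) (x : K) :
    HasDerivAt (seriesEval f) (seriesSlope f x x) x := by
  rw [hasDerivAt_iff_tendsto_slope]
  refine ((hf.continuousAt_slope x).tendsto.mono_left nhdsWithin_le_nhds).congr' ?_
  filter_upwards [self_mem_nhdsWithin] with y hy
  have h1 : y - x ≠ 0 := sub_ne_zero.2 hy
  rw [slope_def_field, eq_div_iff h1, seriesSlope_mul_sub hf]

/-! ### Values taken near a pole and by composites -/

section Values

variable {K : Type*} [NormedField K] [IsUltrametricDist K]

/-- A perturbation below the dominant term changes neither its index nor its norm; hence zeros of f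
can be traded for solutions of f = g. -/
theorem IsLastDominant.sub {f g : PowerSeries K} {r : ℝ} (hr : 0 < r) {n : ℕ}
    (hf : IsLastDominant f r n) (hg : ∀ k, ‖coeff k g‖ * r ^ k < ‖coeff n f‖ * r ^ n) :
    IsLastDominant (f - g) r n ∧ ‖coeff n (f - g)‖ = ‖coeff n f‖ := by
  have heq : ‖coeff n (f - g)‖ = ‖coeff n f‖ := by
    rw [map_sub]
    exact norm_sub_eq_left_of_lt (lt_of_mul_lt_mul_right (hg n) (by positivity))
  refine ⟨⟨fun k => ?_, fun k hk => ?_⟩, heq⟩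
  · rw [heq, map_sub, ← le_div_iff₀ (by positivity)]
    exact norm_sub_le_of_le' ((le_div_iff₀ (by positivity)).2 (hf.le k))
      ((le_div_iff₀ (by positivity)).2 (hg k).le)
  · rw [heq, map_sub, ← lt_div_iff₀ (by positivity)]
    exact norm_sub_lt_of_lt ((lt_div_iff₀ (by positivity)).2 (hf.lt k hk))
      ((lt_div_iff₀ (by positivity)).2 (hg k))

variable [CompleteSpace K] [IsAlgClosed K]

theorem IsEntire.eventually_ne_zero {f : PowerSeries K} (hf : IsEntire f) (h0 : f ≠ 0) (x : K) :
    ∀ᶠ y in 𝓝[≠] x, seriesEval f y ≠ 0 := by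
  have hfin := hf.finite_zeros h0 (‖x‖ + 1)
  have h1 : ({y | ‖y‖ ≤ ‖x‖ + 1 ∧ seriesEval f y = 0} \ {x})ᶜ ∈ 𝓝 x :=
    (hfin.subset Set.sdiff_subset).isClosed.isOpen_compl.mem_nhds (by simp)
  have h2 : Metric.ball (0 : K) (‖x‖ + 1) ∈ 𝓝 x := Metric.isOpen_ball.mem_nhds (by simp)
  filter_upwards [self_mem_nhdsWithin, nhdsWithin_le_nhds h1, nhdsWithin_le_nhds h2]
    with y hy1 hy2 hy3 hy0
  exact hy2 ⟨⟨(mem_ball_zero_iff.1 hy3).le, hy0⟩, hy1⟩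

/-- Near a pole, the quotient `A / B` takes all sufficiently large values. -/
theorem exists_eval_eq_mul_near_pole {A B : PowerSeries K} (hA : IsEntire A) (hB : IsEntire B)
    (hB0 : B ≠ 0) {x₀ : K} (hBx : seriesEval B x₀ = 0) (hAx : seriesEval A x₀ ≠ 0) {V : Set K}
    (hV : V ∈ 𝓝 x₀) :
    ∃ R : ℝ, ∀ y, R < ‖y‖ → ∃ x ∈ V, seriesEval A x = y * seriesEval B x ∧ seriesEval A x ≠ 0 := by
  obtain ⟨ε, hε, hball⟩ := Metric.mem_nhds_iff.1
    (inter_mem hV (hA.continuous.continuousAt.eventually_ne hAx))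
  set r := ‖x₀‖ + 1 with hrdef
  have hr : 0 < r := by positivity
  have hx₀r : ‖x₀‖ ≤ r := by rw [hrdef]; linarith
  obtain ⟨n, hn⟩ := hB.exists_isLastDominant hB0 hr
  have hn1 : 1 ≤ n := by
    by_contra hlt
    obtain rfl : n = 0 := by omega
    exact hn.seriesEval_ne_zero hB hx₀r hBx
  have hM := hn.pos hr.le
  have hBn : 0 < ‖coeff n B‖ := norm_pos_iff.2 (hn.coeff_ne_zero hr.le)
  obtain ⟨c, hc0, hc⟩ := hA.bounded hr.le
  -- The point sought is a zero of B - y⁻¹ A. The first quotient makes y⁻¹ A negligible against the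
  -- dominant term of B; the second brings the zero within ε of x₀.
  refine ⟨max 0 (max (c / (‖coeff n B‖ * r ^ n)) (‖seriesEval A x₀‖ / (‖coeff n B‖ * ε ^ n))),
    fun y hy => ?_⟩
  rw [max_lt_iff, max_lt_iff, div_lt_iff₀ hM, div_lt_iff₀ (by positivity)] at hy
  obtain ⟨hy0, hy1, hy2⟩ := hy
  have hyne : y ≠ 0 := norm_pos_iff.1 hy0
  have hCA : IsEntire (C y⁻¹ * A) := (isEntire_C _).mul hA
  obtain ⟨hd, hdn⟩ := hn.sub hr (g := C y⁻¹ * A) fun k => by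
    rw [coeff_C_mul, norm_mul, norm_inv, mul_assoc, inv_mul_lt_iff₀ hy0]
    exact (hc k).trans_lt hy1
  obtain ⟨ξ, hξ, -, hξx⟩ := hd.exists_zero_near (hB.sub hCA) hr hn1 hx₀r
  rw [seriesEval_sub hB hCA, seriesEval_mul (isEntire_C _) hA, seriesEval_C] at hξ hξx
  rw [hBx, zero_sub, norm_neg, norm_mul, norm_inv, hdn, le_inv_mul_iff₀ hy0] at hξx
  have hdist : ‖ξ - x₀‖ < ε := by
    refine lt_of_pow_lt_pow_left₀ n hε.le ?_
    refine lt_of_mul_lt_mul_left (a := ‖y‖ * ‖coeff n B‖) ?_ (by positivity)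
    calc _ = ‖y‖ * (‖coeff n B‖ * ‖ξ - x₀‖ ^ n) := by ring
      _ ≤ _ := hξx
      _ < _ := hy2
      _ = _ := by ring
  obtain ⟨h1, h2⟩ := hball (by simpa [dist_eq_norm] using hdist : ξ ∈ Metric.ball x₀ ε)
  refine ⟨ξ, h1, ?_, h2⟩
  rw [sub_eq_zero.1 hξ, mul_inv_cancel_left₀ hyne]

omit [IsUltrametricDist K] [CompleteSpace K] [IsAlgClosed K] in
theorem exists_coeff_ne_zero_of_not_polynomial {f : PowerSeries K}
    (hf : ¬ ∃ P : Polynomial K, f = P) : ∃ k, 1 ≤ k ∧ coeff k f ≠ 0 := by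
  by_contra! hc
  refine hf ⟨Polynomial.C (coeff 0 f), ?_⟩
  ext k
  rcases k with _ | k
  · simp
  · rw [hc (k + 1) (by omega), Polynomial.coe_C, coeff_C, if_neg (by omega)]

/-- If `G` and `H` are entire and not polynomials, then `G ∘ H` takes the value `G(0)` at two
distinct points of the same, arbitrarily large, norm. -/
theorem exists_two_zeros_of_comp {G H : PowerSeries K} (hG : IsEntire G) (hH : IsEntire H)
    (hGp : ¬ ∃ P : Polynomial K, G = P) (hHp : ¬ ∃ P : Polynomial K, H = P) (R : ℝ) :
    ∃ x y : K, R ≤ ‖x‖ ∧ ‖x‖ = ‖y‖ ∧ x ≠ y ∧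
      seriesEval G (seriesEval H x) = seriesEval G 0 ∧
      seriesEval G (seriesEval H y) = seriesEval G 0 := by
  -- The radius 0 serves only to make w nonzero.
  obtain ⟨w, hw, hGw⟩ := (hG.sub (isEntire_C (seriesEval G 0))).exists_zero_norm_gt (R := 0) (by
    rintro ⟨P, hP⟩
    exact hGp ⟨P + Polynomial.C (seriesEval G 0), by
      rw [Polynomial.coe_add, Polynomial.coe_C, ← hP, sub_add_cancel]⟩)
  rw [seriesEval_sub hG (isEntire_C _), seriesEval_C, sub_eq_zero] at hGw
  obtain ⟨k, hk, hk0⟩ := exists_coeff_ne_zero_of_not_polynomial hHp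
  obtain ⟨R', hR'⟩ := eventually_atTop.1 ((eventually_gt_atTop (0 : ℝ)).and
    ((eventually_lt_norm_mul_pow hk0 hk ‖w‖).and
      (eventually_lt_norm_mul_pow hk0 hk ‖coeff 0 H‖)))
  obtain ⟨x, hxR, hx⟩ := hH.exists_zero_norm_gt hHp (max R R')
  rw [max_lt_iff] at hxR
  obtain ⟨hr, h1, h2⟩ := hR' ‖x‖ hxR.2.le
  obtain ⟨n, hn⟩ := hH.exists_isLastDominant (by rintro rfl; simp at hk0) hr
  have hn1 := hn.one_le hk h2.le
  have hwM := h1.trans_le (hn.le k)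
  obtain ⟨hd, hdn⟩ := hn.sub hr (g := C w) fun j => by
    rw [coeff_C]
    split_ifs with hj
    · simpa [hj] using hwM
    · simpa using hn.pos hr.le
  obtain ⟨y, hy, -, hyx⟩ := hd.exists_zero_near (hH.sub (isEntire_C w)) hr hn1 le_rfl
  rw [seriesEval_sub hH (isEntire_C _), seriesEval_C, sub_eq_zero] at hy
  rw [seriesEval_sub hH (isEntire_C _), seriesEval_C, hx, zero_sub, norm_neg, hdn] at hyx
  -- Here H(x) - w has norm ‖w‖, below the dominant term of H at radius ‖x‖; hence y is closer to x
  -- than 0 is, and has the same norm.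
  have hlt : ‖y - x‖ < ‖x‖ := by
    refine lt_of_pow_lt_pow_left₀ n (norm_nonneg _) ?_
    exact lt_of_mul_lt_mul_left (hyx.trans_lt hwM) (norm_nonneg _)
  have hyn : ‖y‖ = ‖x‖ := by
    have := norm_add_eq_left_of_lt hlt
    rwa [add_sub_cancel] at this
  refine ⟨x, y, hxR.1.le, hyn.symm, ?_, by rw [hx], by rw [hy, hGw]⟩
  rintro rfl
  rw [hx] at hy
  simp [← hy] at hw

end Values

variable {p : ℕ} [Fact p.Prime]

/-! ### Transfer to the ring of entire functions -/

section EntireRing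

theorem Entire.isEntire (f : Entire p) : IsEntire (f : PowerSeries ℂ_[p]) := f.2

theorem Entire.eval_eq (f : Entire p) (x : ℂ_[p]) : f.eval x = seriesEval f x := rfl

theorem Entire.eval_mul (f g : Entire p) (x : ℂ_[p]) : (f * g).eval x = f.eval x * g.eval x :=
  seriesEval_mul f.isEntire g.isEntire x

theorem Entire.eval_sub (f g : Entire p) (x : ℂ_[p]) : (f - g).eval x = f.eval x - g.eval x :=
  seriesEval_sub f.isEntire g.isEntire x

theorem Entire.continuous_eval (f : Entire p) : Continuous f.eval := f.isEntire.continuous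

theorem Entire.eventually_eval_ne_zero {f : Entire p} (hf : f ≠ 0) (x : ℂ_[p]) :
    ∀ᶠ y in 𝓝[≠] x, f.eval y ≠ 0 :=
  f.isEntire.eventually_ne_zero (fun h => hf (Subtype.ext h)) x

/-- A polynomial, as an entire function. -/
noncomputable def Entire.ofPolynomial (P : Polynomial ℂ_[p]) : Entire p :=
  ⟨P, isEntire_polynomial P⟩

theorem Entire.eval_ofPolynomial (P : Polynomial ℂ_[p]) (x : ℂ_[p]) :
    (Entire.ofPolynomial P).eval x = P.eval x := seriesEval_polynomial P x

theorem Entire.ofPolynomial_isPolynomial (P : Polynomial ℂ_[p]) :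
    (Entire.ofPolynomial P).IsPolynomial := ⟨P, rfl⟩

theorem Entire.ofPolynomial_ne_zero {P : Polynomial ℂ_[p]} (hP : P ≠ 0) :
    Entire.ofPolynomial P ≠ 0 := fun h => hP
  (Polynomial.coe_eq_zero_iff.1 (congrArg Subtype.val h : (P : PowerSeries ℂ_[p]) = 0))

theorem Entire.ne_zero_of_eval_ne_zero {f : Entire p} {x : ℂ_[p]} (h : f.eval x ≠ 0) : f ≠ 0 := by
  rintro rfl
  exact h (by simp [Entire.eval])

theorem Entire.IsPolynomial.isRational_div {a b : Entire p} (ha : a.IsPolynomial)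
    (hb : b.IsPolynomial) (hb0 : b ≠ 0) :
    Mero.IsRational (algebraMap (Entire p) (Mero p) a / algebraMap (Entire p) (Mero p) b) :=
  ⟨a, b, ha, hb, hb0, rfl⟩

theorem Entire.IsPolynomial.isRational {a : Entire p} (ha : a.IsPolynomial) :
    Mero.IsRational (algebraMap (Entire p) (Mero p) a) := by
  have h := ha.isRational_div (Entire.ofPolynomial_isPolynomial 1)
    (Entire.ofPolynomial_ne_zero one_ne_zero)
  rwa [show Entire.ofPolynomial (1 : Polynomial ℂ_[p]) = 1 from Subtype.ext Polynomial.coe_one,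
    map_one, div_one] at h

end EntireRing

/-! ### Meromorphic functions: local quotients, values, poles -/

namespace Mero

theorem div_eq_div_iff_mul_eq {a b c d : Entire p} (hb : b ≠ 0) (hd : d ≠ 0) :
    algebraMap (Entire p) (Mero p) a / algebraMap (Entire p) (Mero p) b =
      algebraMap (Entire p) (Mero p) c / algebraMap (Entire p) (Mero p) d ↔ a * d = c * b := by
  have hinj := IsFractionRing.injective (Entire p) (Mero p)
  rw [div_eq_div_iff ((map_ne_zero_iff _ hinj).2 hb) ((map_ne_zero_iff _ hinj).2 hd), ← map_mul,
    ← map_mul, hinj.eq_iff]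

/-- Every meromorphic function is, near a given point, a quotient without common zero. -/
theorem exists_eq_div (h : Mero p) (x : ℂ_[p]) : ∃ A B : Entire p, B ≠ 0 ∧
    h = algebraMap (Entire p) (Mero p) A / algebraMap (Entire p) (Mero p) B ∧
      (B.eval x = 0 → A.eval x ≠ 0) := by
  obtain ⟨A, B, hB, rfl⟩ := IsFractionRing.div_surjective (A := Entire p) h
  have hB0 : B ≠ 0 := nonZeroDivisors.ne_zero hB
  clear hB
  have hr : 0 < ‖x‖ + 1 := by positivity
  obtain ⟨n, hn⟩ := B.isEntire.exists_isLastDominant (fun h => hB0 (Subtype.ext h)) hr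
  -- Each cancelled common factor X - x lowers the dominant index of the denominator, so
  -- cancellation terminates.
  induction n generalizing A B with
  | zero =>
    exact ⟨A, B, hB0, rfl, fun h => absurd h (hn.seriesEval_ne_zero B.isEntire (by linarith))⟩
  | succ n ih =>
    by_cases hBx : B.eval x = 0
    · by_cases hAx : A.eval x = 0
      · let A' : Entire p := ⟨divXSub A x, A.isEntire.divXSub x⟩
        let B' : Entire p := ⟨divXSub B x, B.isEntire.divXSub x⟩
        have hA : Entire.ofPolynomial (Polynomial.X - Polynomial.C x) * A' = A := Subtype.ext (by
          have := X_sub_C_mul_divXSub A.isEntire hAx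
          simpa [Entire.ofPolynomial, A'] using this)
        have hB : Entire.ofPolynomial (Polynomial.X - Polynomial.C x) * B' = B := Subtype.ext (by
          have := X_sub_C_mul_divXSub B.isEntire hBx
          simpa [Entire.ofPolynomial, B'] using this)
        have hB'0 : B' ≠ 0 := by
          intro h0; rw [h0, mul_zero] at hB; exact hB0 hB.symm
        obtain ⟨A₁, B₁, h1, h2, h3⟩ := ih A' B' hB'0
          (hn.divXSub B.isEntire hr (by linarith))
        refine ⟨A₁, B₁, h1, ?_, h3⟩
        rw [← h2, div_eq_div_iff_mul_eq hB0 hB'0]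
        calc A * B' = (Entire.ofPolynomial (Polynomial.X - Polynomial.C x) * A') * B' := by rw [hA]
          _ = A' * (Entire.ofPolynomial (Polynomial.X - Polynomial.C x) * B') := by ring
          _ = A' * B := by rw [hB]
      · exact ⟨A, B, hB0, rfl, fun _ => hAx⟩
    · exact ⟨A, B, hB0, rfl, fun h => absurd h hBx⟩

theorem hasValueAt_div {A B : Entire p} {x : ℂ_[p]} (hB : B.eval x ≠ 0) :
    HasValueAt (algebraMap (Entire p) (Mero p) A / algebraMap (Entire p) (Mero p) B) x
      (A.eval x / B.eval x) := ⟨A, B, hB, rfl, rfl⟩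

/-- Cross-multiplied, so that it also holds where this particular denominator B vanishes. -/
theorem HasValueAt.eval_eq {A B : Entire p} {x y : ℂ_[p]} (hB : B ≠ 0)
    (h : HasValueAt (algebraMap (Entire p) (Mero p) A / algebraMap (Entire p) (Mero p) B) x y) :
    A.eval x = y * B.eval x := by
  obtain ⟨a, b, hb, he, rfl⟩ := h
  rw [div_eq_div_iff_mul_eq hB (Entire.ne_zero_of_eval_ne_zero hb)] at he
  have h1 := congrArg (fun g => Entire.eval g x) he
  simp only [Entire.eval_mul] at h1
  field_simp
  exact h1

theorem hasValueAt_algebraMap (f : Entire p) (x : ℂ_[p]) :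
    HasValueAt (algebraMap (Entire p) (Mero p) f) x (f.eval x) := by
  have h1 : (1 : Entire p).eval x = 1 := by
    rw [Entire.eval_eq]; simpa using seriesEval_C (1 : ℂ_[p]) x
  have := hasValueAt_div (A := f) (B := 1) (x := x) (by rw [h1]; exact one_ne_zero)
  simpa [h1] using this

theorem HasValueAt.eq_eval {f : Entire p} {x z : ℂ_[p]}
    (h : HasValueAt (algebraMap (Entire p) (Mero p) f) x z) : f.eval x = z := by
  have h1 : (1 : Entire p).eval x = 1 := by
    rw [Entire.eval_eq]; simpa using seriesEval_C (1 : ℂ_[p]) x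
  have h2 : HasValueAt (algebraMap (Entire p) (Mero p) f / algebraMap (Entire p) (Mero p) 1) x z :=
    by simpa using h
  simpa [h1] using h2.eval_eq (one_ne_zero : (1 : Entire p) ≠ 0)

/-- A meromorphic function without poles is entire. -/
theorem exists_eq_algebraMap (h : Mero p) (hreg : ∀ x, ∃ y, h.HasValueAt x y) :
    ∃ f : Entire p, h = algebraMap (Entire p) (Mero p) f := by
  obtain ⟨A, B, hB0, rfl, -⟩ := h.exists_eq_div 0
  obtain ⟨Q, hQ, hAB⟩ := A.isEntire.exists_eq_mul B.isEntire (fun h => hB0 (Subtype.ext h))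
    fun x => by
      obtain ⟨y, a, b, hb, he, -⟩ := hreg x
      rw [div_eq_div_iff_mul_eq hB0 (Entire.ne_zero_of_eval_ne_zero hb)] at he
      exact ⟨a, b, a.isEntire, b.isEntire, hb, (congrArg Subtype.val he).symm⟩
  refine ⟨⟨Q, hQ⟩, ?_⟩
  have hAB' : A = B * ⟨Q, hQ⟩ := Subtype.ext hAB
  have hB1 : algebraMap (Entire p) (Mero p) B ≠ 0 :=
    (map_ne_zero_iff _ (IsFractionRing.injective (Entire p) (Mero p))).2 hB0
  rw [hAB', map_mul, mul_div_cancel_left₀ _ hB1]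

theorem isRational_of_sub_eq_zero {a b : Entire p} (hb : b ≠ 0) {y : ℂ_[p]}
    (h : a - Entire.ofPolynomial (Polynomial.C y) * b = 0) :
    IsRational (algebraMap (Entire p) (Mero p) a / algebraMap (Entire p) (Mero p) b) := by
  have hb1 : algebraMap (Entire p) (Mero p) b ≠ 0 :=
    (map_ne_zero_iff _ (IsFractionRing.injective (Entire p) (Mero p))).2 hb
  rw [sub_eq_zero.1 h, map_mul, mul_div_cancel_right₀ _ hb1]
  exact (Entire.ofPolynomial_isPolynomial _).isRational

/-! ### Reducing a factorization to entire factors -/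

section Composition

variable {F : Entire p} {g h : Mero p}

theorem IsComp.eval_eq (hF : IsComp (algebraMap (Entire p) (Mero p) F) g h) {x y z : ℂ_[p]}
    (hx : h.HasValueAt x y) (hy : g.HasValueAt y z) : F.eval x = z :=
  (hF.2 x y z hx hy).eq_eval

/-- If `g ∘ h` is entire and `h` is not constant, then `h` omits the poles of `g`. -/
theorem IsComp.exists_hasValueAt (hF : IsComp (algebraMap (Entire p) (Mero p) F) g h)
    (hh : ¬ h.IsRational) {x y : ℂ_[p]} (hx : h.HasValueAt x y) : ∃ z, g.HasValueAt y z := by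
  obtain ⟨G, D, hD0, rfl, hGD⟩ := g.exists_eq_div y
  by_cases hDy : D.eval y = 0
  swap
  · exact ⟨_, hasValueAt_div hDy⟩
  exfalso
  obtain ⟨a, b, hb, rfl, rfl⟩ := hx
  have hb0 := Entire.ne_zero_of_eval_ne_zero hb
  set y := a.eval x / b.eval x with hy
  set H : ℂ_[p] → ℂ_[p] := fun t => a.eval t / b.eval t with hH
  have hHc : ContinuousAt H x :=
    a.continuous_eval.continuousAt.div b.continuous_eval.continuousAt hb
  have hne : a - Entire.ofPolynomial (Polynomial.C y) * b ≠ 0 :=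
    fun h0 => hh (isRational_of_sub_eq_zero hb0 h0)
  have hbev : ∀ᶠ t in 𝓝[≠] x, b.eval t ≠ 0 :=
    nhdsWithin_le_nhds (b.continuous_eval.continuousAt.eventually_ne hb)
  -- Because h is not constant, it avoids y on a punctured neighbourhood of x; there D ∘ H does not
  -- vanish and the composition identity applies.
  have hHt : Tendsto H (𝓝[≠] x) (𝓝[≠] y) := by
    refine tendsto_nhdsWithin_iff.2 ⟨hHc.tendsto.mono_left nhdsWithin_le_nhds, ?_⟩
    filter_upwards [Entire.eventually_eval_ne_zero hne x, hbev] with t ht hbt hty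
    refine ht ?_
    rw [Entire.eval_sub, Entire.eval_mul, Entire.eval_ofPolynomial, Polynomial.eval_C, sub_eq_zero]
    exact (div_eq_iff hbt).1 hty
  have hev : ∀ᶠ t in 𝓝[≠] x, F.eval t * D.eval (H t) = G.eval (H t) := by
    filter_upwards [hbev, hHt.eventually (Entire.eventually_eval_ne_zero hD0 y)] with t hbt hDt
    rw [hF.eval_eq (hasValueAt_div hbt) (hasValueAt_div hDt), div_mul_cancel₀ _ hDt]
  have hHy : Tendsto H (𝓝[≠] x) (𝓝 y) := hHt.mono_right nhdsWithin_le_nhds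
  have h1 : Tendsto (fun t => F.eval t * D.eval (H t)) (𝓝[≠] x) (𝓝 (F.eval x * D.eval y)) :=
    (F.continuous_eval.continuousAt.tendsto.mono_left nhdsWithin_le_nhds).mul
      ((D.continuous_eval.tendsto y).comp hHy)
  have h2 : Tendsto (fun t => G.eval (H t)) (𝓝[≠] x) (𝓝 (G.eval y)) :=
    (G.continuous_eval.tendsto y).comp hHy
  -- Letting t tend to x in F · (D ∘ H) = G ∘ H gives G(y) = 0, although G and D have no common zero
  -- at y.
  have h3 := tendsto_nhds_unique (h1.congr' hev) h2
  rw [hDy, mul_zero] at h3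
  exact hGD hDy h3.symm

/-- A meromorphic function whose poles lie in a disc is the quotient of an entire function by a
polynomial. -/
theorem exists_eq_div_ofPolynomial (g : Mero p) (R : ℝ)
    (hg : ∀ y, R < ‖y‖ → ∃ z, g.HasValueAt y z) : ∃ (Q : Entire p) (P : Polynomial ℂ_[p]), P ≠ 0 ∧
      g = algebraMap (Entire p) (Mero p) Q /
        algebraMap (Entire p) (Mero p) (Entire.ofPolynomial P) := by
  obtain ⟨G, D, hD0, rfl, -⟩ := g.exists_eq_div 0
  obtain ⟨P, U, hP, hU, hUd, hDPU⟩ := D.isEntire.exists_eq_polynomial_mul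
    (fun h => hD0 (Subtype.ext h)) (lt_max_of_lt_right one_pos : 0 < max R 1)
  have hU0 : U ≠ 0 := by
    rintro rfl; exact hUd.coeff_ne_zero (by positivity) (by simp)
  -- G / U = g · P has no pole: U has no zero in the disc, and g is regular outside it.
  obtain ⟨Q, hQ, hGQ⟩ := G.isEntire.exists_eq_mul hU hU0 fun y => by
    by_cases hy : ‖y‖ ≤ max R 1
    · exact ⟨G, U, G.isEntire, hU, hUd.seriesEval_ne_zero hU hy, rfl⟩
    · obtain ⟨z, a, b, hb, he, -⟩ := hg y (lt_of_le_of_lt (le_max_left _ _) (not_le.1 hy))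
      rw [div_eq_div_iff_mul_eq hD0 (Entire.ne_zero_of_eval_ne_zero hb)] at he
      have he' : (G : PowerSeries ℂ_[p]) * b = a * D := congrArg Subtype.val he
      exact ⟨a * P, b, a.isEntire.mul (isEntire_polynomial P), b.isEntire, hb, by
        rw [he', hDPU, mul_assoc]⟩
  refine ⟨⟨Q, hQ⟩, P, hP, ?_⟩
  rw [div_eq_div_iff_mul_eq hD0 (Entire.ofPolynomial_ne_zero hP)]
  refine Subtype.ext ?_
  change (G : PowerSeries ℂ_[p]) * P = Q * D
  rw [hGQ, hDPU]; ring

/-- If `g ∘ h` is entire and neither `g` nor `h` is rational, then `h` has no pole. -/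
theorem IsComp.regular_right (hF : IsComp (algebraMap (Entire p) (Mero p) F) g h)
    (hg : ¬ g.IsRational) (hh : ¬ h.IsRational) (x₀ : ℂ_[p]) : ∃ y, h.HasValueAt x₀ y := by
  classical
  obtain ⟨A, B, hB0, hAB, hABx⟩ := h.exists_eq_div x₀
  by_cases hBx : B.eval x₀ = 0
  swap
  · exact ⟨_, hAB ▸ hasValueAt_div hBx⟩
  exfalso
  have hB0' : (B : PowerSeries ℂ_[p]) ≠ 0 := fun h => hB0 (Subtype.ext h)
  have hval : ∀ x y, A.eval x = y * B.eval x → A.eval x ≠ 0 → h.HasValueAt x y := by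
    intro x y hxy hAx
    have hBx : B.eval x ≠ 0 := by rintro h0; exact hAx (by rw [hxy, h0, mul_zero])
    rw [hAB, eq_div_of_mul_eq hBx hxy.symm]
    exact hasValueAt_div hBx
  obtain ⟨R, hR⟩ := exists_eval_eq_mul_near_pole A.isEntire B.isEntire hB0' hBx (hABx hBx)
    (univ_mem : Set.univ ∈ 𝓝 x₀)
  have hreg : ∀ y, R < ‖y‖ → ∃ z, g.HasValueAt y z := by
    intro y hy
    obtain ⟨x, -, h1, h2⟩ := hR y hy
    exact hF.exists_hasValueAt hh (hval x y h1 h2)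
  obtain ⟨Q, P, hP, rfl⟩ := g.exists_eq_div_ofPolynomial R hreg
  -- Any value other than F(x₀) would do. By continuity F avoids w near x₀, whereas g takes the
  -- value w at some large y, which h attains near x₀.
  set w := F.eval x₀ + 1 with hw
  obtain ⟨R', hR'⟩ := exists_eval_eq_mul_near_pole A.isEntire B.isEntire hB0' hBx (hABx hBx)
    (F.continuous_eval.continuousAt.eventually_ne (show F.eval x₀ ≠ w by simp [hw]))
  obtain ⟨R'', hR''⟩ := P.roots.toFinset.finite_toSet.isBounded.exists_norm_le
  -- If Q - wP were a polynomial, g = Q / P would be rational.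
  have hQ : ¬ ∃ T : Polynomial ℂ_[p], (Q : PowerSeries ℂ_[p]) -
      ((Polynomial.C w * P : Polynomial ℂ_[p]) : PowerSeries ℂ_[p]) = T := by
    rintro ⟨T, hT⟩
    refine hg (Entire.IsPolynomial.isRational_div ⟨T + Polynomial.C w * P, ?_⟩
      (Entire.ofPolynomial_isPolynomial P) (Entire.ofPolynomial_ne_zero hP))
    rw [Polynomial.coe_add, ← hT, sub_add_cancel]
  obtain ⟨y, hy, hQy⟩ := (Q.isEntire.sub (isEntire_polynomial _)).exists_zero_norm_gt hQ
    (max R' R'')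
  rw [max_lt_iff] at hy
  rw [seriesEval_sub Q.isEntire (isEntire_polynomial _), seriesEval_polynomial, Polynomial.eval_mul,
    Polynomial.eval_C, sub_eq_zero] at hQy
  have hPy : P.eval y ≠ 0 := by
    intro h0
    have := hR'' y (by simpa [hP] using h0)
    linarith
  obtain ⟨x, hx, h1, h2⟩ := hR' y hy.1
  refine hx ?_
  have hPy' : (Entire.ofPolynomial P).eval y ≠ 0 := by rwa [Entire.eval_ofPolynomial]
  rw [hF.eval_eq (hval x y h1 h2) (hasValueAt_div hPy'), Entire.eval_ofPolynomial,
    div_eq_iff hPy, Entire.eval_eq, hQy]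

/-- A factorization of an entire function into two nonrational meromorphic functions is a
factorization into entire functions that are not polynomials. -/
theorem IsComp.exists_entire (hF : IsComp (algebraMap (Entire p) (Mero p) F) g h)
    (hg : ¬ g.IsRational) (hh : ¬ h.IsRational) : ∃ G H : Entire p, ¬ G.IsPolynomial ∧
      ¬ H.IsPolynomial ∧ ∀ x, F.eval x = G.eval (H.eval x) := by
  obtain ⟨H, rfl⟩ := h.exists_eq_algebraMap (hF.regular_right hg hh)
  have hH : ¬ H.IsPolynomial := fun h => hh h.isRational
  -- H is surjective, so having no pole of g among its values means that g has no pole.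
  have hreg : ∀ y, ∃ z, g.HasValueAt y z := by
    intro y
    obtain ⟨x, -, hx⟩ := (H.isEntire.sub (isEntire_C y)).exists_zero_norm_gt (R := 0) (by
      rintro ⟨P, hP⟩
      exact hH ⟨P + Polynomial.C y, by
        rw [Polynomial.coe_add, Polynomial.coe_C, ← hP, sub_add_cancel]⟩)
    rw [seriesEval_sub H.isEntire (isEntire_C _), seriesEval_C, sub_eq_zero] at hx
    exact hF.exists_hasValueAt hh (x := x) (hx ▸ hasValueAt_algebraMap H x)
  obtain ⟨G, rfl⟩ := g.exists_eq_algebraMap hreg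
  exact ⟨G, H, fun h => hg h.isRational, hH, fun x =>
    hF.eval_eq (hasValueAt_algebraMap H x) (hasValueAt_algebraMap G _)⟩

end Composition

end Mero

end PadicFactorization

/-! ### The two conclusions -/

theorem theorem2p9 (p : ℕ) [Fact p.Prime] (f : Entire p) (a : ℕ → ℂ_[p])
    (ha : ∀ n : ℕ, a n = PowerSeries.coeff n (f : PowerSeries ℂ_[p]))
    (N : ℕ) (hlow : ∀ n < N, a n = 0) (hne : ∀ n ≥ N, a n ≠ 0)
    (n₀ : ℕ) (hn₀ : N ≤ n₀)
    (hmono : StrictMonoOn (fun n : ℕ => ‖a n / a (n + 1)‖) (Set.Ici n₀))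
    (hunb : ¬ BddAbove ((fun n : ℕ => ‖a n / a (n + 1)‖) '' Set.Ici n₀)) :
    (algebraMap (Entire p) (Mero p) f).IsPseudoPrime ∧
      ∀ β : ℂ_[p], {x : ℂ_[p] | IsMultipleZero (fun z => f.eval z - β) x}.Finite := by
  obtain rfl : a = fun n => PowerSeries.coeff n (f : PowerSeries ℂ_[p]) := funext ha
  have key := exists_forall_seriesSlope_ne_zero f.isEntire (fun n hn => hne n (hn₀.trans hn))
    hmono hunb
  refine ⟨fun g h hcomp => ?_, fun β => ?_⟩
  · by_contra! hgh
    obtain ⟨G, H, hG, hH, hGH⟩ := hcomp.exists_entire hgh.1 hgh.2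
    obtain ⟨R, hR⟩ := key (G.eval 0)
    obtain ⟨x, y, hx, hxy, hne', h1, h2⟩ := exists_two_zeros_of_comp G.isEntire H.isEntire hG hH R
    have hfx : seriesEval f x = G.eval 0 := (hGH x).trans h1
    have hfy : seriesEval f y = G.eval 0 := (hGH y).trans h2
    have h3 := seriesSlope_mul_sub f.isEntire x y
    rw [hfx, hfy, sub_self, mul_eq_zero] at h3
    exact h3.elim (hR x y hx hxy hfx hfy) (sub_ne_zero.2 hne')
  · obtain ⟨R, hR⟩ := key β
    have hf0 : (f : PowerSeries ℂ_[p]) - PowerSeries.C β ≠ 0 := by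
      intro h0
      -- The index n₀ + 1 is positive, so the constant β does not affect this coefficient.
      have h1 := congrArg (PowerSeries.coeff (n₀ + 1)) h0
      rw [map_sub, PowerSeries.coeff_C, if_neg (by omega), sub_zero, map_zero] at h1
      exact hne (n₀ + 1) (by omega) h1
    refine ((f.isEntire.sub (isEntire_C β)).finite_zeros hf0 R).subset fun x hx => ?_
    have hfx : seriesEval f x = β := sub_eq_zero.1 hx.1
    refine ⟨?_, by rw [seriesEval_sub f.isEntire (isEntire_C β), seriesEval_C, hfx, sub_self]⟩
    by_contra! hlt
    have h1 : deriv (fun z => f.eval z - β) x = seriesSlope f x x :=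
      ((f.isEntire.hasDerivAt x).sub_const β).deriv
    exact hR x x hlt.le rfl hfx hfx (h1 ▸ hx.2)
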